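/- For $n\ge 1$ and $\sigma\in S_n$ let $\alpha_j(\sigma)$ be the number of cycles of length $j$ of $\sigma$ (fixed points being cycles of length $1$). Let $\hat d(1),\hat d(2),\ldots$ be a fixed sequence of real numbers for which there are constants $d^-,d^+$ with $0<d^-\le \hat d(j)\le d^+<\infty$ for all $j\ge 1$, and let $\hat f(1),\hat f(2),\ldots$ be a fixed sequence of complex numbers such that $|\hat f(j)|\le 1$ for all $j\ge1$ and $\lim_{k\to\infty}\hat f(k)=1$. Define the multiplicative functions $d(\sigma)=\prod_{j=1}^n \hat d(j)^{\alpha_j(\sigma)}$ and $f(\sigma)=\prod_{j=1}^n \hat f(j)^{\alpha_j(\sigma)}$ on $S_n$ (with $0^0=1$), the probability measure $\nu_{n,d}(\sigma)=d(\sigma)/\sum_{\tau\in S_n}d(\tau)$ on $S_n$, and the mean value $M_n^d(f)=\sum_{\sigma\in S_n}f(\sigma)\,\nu_{n,d}(\sigma)$. Then, for every $n\ge 1$, the series $\sum_{j\ge1}\hat d(j)\frac{\hat f(j)-1}{j}e^{-j/n}$ converges absolutely, and \[ M_n^d(f)=\frac{\sum_{\sigma\in S_n}f(\sigma)d(\sigma)}{\sum_{\sigma\in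 S_n}d(\sigma)}=\exp\left\{\sum_{j=1}^{\infty}\hat d(j)\,\frac{\hat f(j)-1}{j}\,e^{-j/n}\right\}+o(1)\qquad\text{as } n\to\infty . \] -/

import Mathlib

open Filter Topology

noncomputable section

/-- The number `α_j(σ)` of cycles of length `j` in the permutation `σ`; fixed points are counted
as cycles of length `1`. -/
def cycleCount {n : ℕ} (σ : Equiv.Perm (Fin n)) (j : ℕ) : ℕ :=
  σ.partition.parts.count j

/-- The multiplicative function on `S_n` attached to the sequence `g 1, g 2, …`:
`σ ↦ g(1)^{α_1(σ)} ⋯ g(n)^{α_n(σ)}`, with `0 ^ 0 = 1`. -/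
def multFun {R : Type*} [CommMonoid R] (g : ℕ → R) {n : ℕ} (σ : Equiv.Perm (Fin n)) : R :=
  ∏ j ∈ Finset.Icc 1 n, g j ^ cycleCount σ j

/-- The measure `ν_{n,d}` on `S_n`: the weight `d(σ) / ∑_τ d(τ)` of the permutation `σ`. -/
def permWeight (d : ℕ → ℝ) {n : ℕ} (σ : Equiv.Perm (Fin n)) : ℝ :=
  multFun d σ / ∑ τ : Equiv.Perm (Fin n), multFun d τ

/-- The mean value `M_n^d(f)` of the multiplicative function `f` with respect to `ν_{n,d}`. -/
def weightedMean (d : ℕ → ℝ) (f : ℕ → ℂ) (n : ℕ) : ℂ :=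
  ∑ σ : Equiv.Perm (Fin n), multFun f σ * (permWeight d σ : ℂ)

/-- The term of index `j` of the series `∑_{j ≥ 1} d(j) (f(j) - 1) / j * e^{-j/n}`. -/
def expSeriesTerm (d : ℕ → ℝ) (f : ℕ → ℂ) (n j : ℕ) : ℂ :=
  (d j : ℂ) * ((f j - 1) / (j : ℂ)) * (Real.exp (-(j : ℝ) / (n : ℝ)) : ℂ)

end

/-!
Let `p n` and `m n` be the means over `S_n` of `d` and of `d * f` with respect to counting measure;
both are coefficients of exponentials of power series, and the quotient of the two generating
functions is `F s = exp (∑ d j * (f j - 1) / j * s ^ j)`. Since `f j → 1`, `F` varies slowly as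
`s → 1⁻`, and the claim is that `D n = m n / p n - F (exp (-1 / n))` tends to `0`. This is a
Tauberian statement: slow variation makes the Abel means of `D` (with weights `p n * s ^ n`) vanish
in the limit. The Tauberian condition is the logarithmic derivative of the generating functions:
up to `o(1)`, `D n` is the average of `D k` over `k < n` with weights proportional to
`d (n - k) * p k`. As `d` is bounded below, these weights dominate a fixed proportion of the smooth
weights `p k * ρ ^ k * (ρ ^ k - ρ ^ n)`, `ρ = exp (-c / n)`, against which `D` averages to `o(1)`
because its Abel means at `ρ` and `ρ ^ 2` do. Only the remaining proportion of the mass matters, so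
`limsup ‖D n‖` is at most a constant `q < 1` times itself, hence zero.
-/

/-- The weight `∏ⱼ (g j / j) ^ αⱼ / αⱼ!` of a multiset with multiplicities `αⱼ`. By Cauchy's formula
it is, up to the factor `n!`, the total contribution to `∑ σ, multFun g σ` of the permutations of
cycle type `s`. -/
noncomputable def partsWeight {K : Type*} [Field K] (g : ℕ → K) (s : Multiset ℕ) : K :=
  ∏ j ∈ s.toFinset, (g j / j) ^ s.count j / (s.count j).factorial

section CycleCounting

open Finset

theorem filter_two_le_add_replicate {s : Multiset ℕ} (hs : ∀ i ∈ s, 0 < i) :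
    s.filter (2 ≤ ·) + Multiset.replicate (s.count 1) 1 = s := by
  ext a
  rw [Multiset.count_add, Multiset.count_replicate, Multiset.count_filter]
  rcases eq_or_ne a 1 with rfl | ha
  · simp
  · by_cases h2 : 2 ≤ a
    · simp [h2, ha.symm]
    · have ha0 : a = 0 := by omega
      have hs0 : s.count a = 0 := Multiset.count_eq_zero.2 fun h => (hs a h).ne' ha0
      simp [h2, hs0, ha.symm]

theorem parts_partition_eq_iff {n : ℕ} (σ : Equiv.Perm (Fin n)) (l : n.Partition) :
    σ.partition.parts = l.parts ↔ σ.cycleType = l.parts.filter (2 ≤ ·) := by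
  refine ⟨fun h => h ▸ σ.filter_parts_partition_eq_cycleType.symm, fun h => ?_⟩
  have hsplit := filter_two_le_add_replicate fun i hi => l.parts_pos (i := i) hi
  have hsum := congrArg Multiset.sum hsplit
  rw [Multiset.sum_add, Multiset.sum_replicate, smul_eq_mul, mul_one, l.parts_sum, ← h] at hsum
  rw [Equiv.Perm.parts_partition, ← Equiv.Perm.sum_cycleType, Fintype.card_fin,
    Nat.sub_eq_of_eq_add' hsum.symm, h, hsplit]

theorem card_parts_partition_eq_mul {n : ℕ} (l : n.Partition) :
    #{σ : Equiv.Perm (Fin n) | σ.partition.parts = l.parts} *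
      (l.parts.prod * ∏ j ∈ l.parts.toFinset, (l.parts.count j).factorial) = n.factorial := by
  have hsplit := filter_two_le_add_replicate fun i hi => l.parts_pos (i := i) hi
  set t := l.parts.filter (2 ≤ ·) with ht
  have hsum : t.sum + l.parts.count 1 = n := by
    simpa [l.parts_sum] using congrArg Multiset.sum hsplit
  have hprod : l.parts.prod = t.prod := by
    simpa using congrArg Multiset.prod hsplit.symm
  have hcount : ∏ j ∈ l.parts.toFinset, (l.parts.count j).factorial
      = (l.parts.count 1).factorial * ∏ j ∈ t.toFinset, (t.count j).factorial := by
    have ht_count : ∀ j ∈ t.toFinset, (t.count j).factorial = (l.parts.count j).factorial :=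
      fun j hj => by
        rw [ht, Multiset.count_filter_of_pos (Multiset.mem_filter.1 (Multiset.mem_toFinset.1 hj)).2]
    rw [prod_congr rfl ht_count,
      ← prod_insert (f := fun j => (l.parts.count j).factorial) (by simp [ht])]
    refine prod_subset (fun j hj => ?_) fun j _ hj => ?_
    · have := l.parts_pos (Multiset.mem_toFinset.1 hj)
      by_cases hj1 : j = 1
      · simp [hj1]
      · have : 2 ≤ j := by omega
        simp_all
    · rw [Multiset.count_eq_zero.2 (mt Multiset.mem_toFinset.2 hj), Nat.factorial_zero]
  have hcard := Equiv.Perm.card_of_cycleType_mul_eq (Fin n) t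
  rw [if_pos ⟨by simp; omega, fun a ha => (Multiset.mem_filter.1 ha).2⟩, Fintype.card_fin,
    ← hsum, Nat.add_sub_cancel_left, hsum] at hcard
  rw [hprod, hcount, filter_congr fun σ _ => parts_partition_eq_iff σ l, ← hcard]
  ring

theorem multFun_eq_prod_map {R : Type*} [CommMonoid R] (g : ℕ → R) {n : ℕ}
    (σ : Equiv.Perm (Fin n)) : multFun g σ = (σ.partition.parts.map g).prod := by
  rw [prod_multiset_map_count]
  refine (prod_subset (fun j hj => ?_) fun j _ hj => ?_).symm
  · have hj := Multiset.mem_toFinset.1 hj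
    exact mem_Icc.2 ⟨σ.partition.parts_pos hj, by simpa using σ.partition.le_of_mem_parts hj⟩
  · rw [cycleCount, Multiset.count_eq_zero.2 (mt Multiset.mem_toFinset.2 hj), pow_zero]

variable {K : Type*} [Field K] [CharZero K]

theorem card_parts_partition_eq_mul_prod_map (g : ℕ → K) {n : ℕ} (l : n.Partition) :
    #{σ : Equiv.Perm (Fin n) | σ.partition.parts = l.parts} * (l.parts.map g).prod
      = n.factorial * partsWeight g l.parts := by
  have hparts : (l.parts.prod : K) ≠ 0 := by
    exact_mod_cast Multiset.prod_ne_zero fun h => (l.parts_pos h).ne rfl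
  have hfact : ((∏ j ∈ l.parts.toFinset, (l.parts.count j).factorial : ℕ) : K) ≠ 0 := by
    exact_mod_cast prod_ne_zero_iff.2 fun j _ => Nat.factorial_ne_zero _
  have hweight : partsWeight g l.parts = (l.parts.map g).prod /
      (l.parts.prod * (∏ j ∈ l.parts.toFinset, (l.parts.count j).factorial : ℕ)) := by
    rw [partsWeight, prod_div_distrib, ← prod_multiset_map_count l.parts fun j => g j / (j : K),
      Multiset.prod_map_div, ← Nat.cast_multiset_prod, Nat.cast_prod, div_div]
  rw [hweight, ← card_parts_partition_eq_mul l]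
  push_cast at hfact hparts ⊢
  field_simp

theorem sum_multFun_div_factorial (g : ℕ → K) (n : ℕ) :
    (∑ σ : Equiv.Perm (Fin n), multFun g σ) / n.factorial
      = ∑ l : n.Partition, partsWeight g l.parts := by
  have hfact : (n.factorial : K) ≠ 0 := Nat.cast_ne_zero.2 n.factorial_ne_zero
  rw [div_eq_iff hfact, mul_comm, mul_sum]
  have hcast : Fintype.card (Fin n) = n := Fintype.card_fin n
  let shape : Equiv.Perm (Fin n) → n.Partition := fun σ =>
    ⟨σ.partition.parts, σ.partition.parts_pos, σ.partition.parts_sum.trans hcast⟩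
  rw [← sum_fiberwise univ shape]
  refine sum_congr rfl fun l _ => ?_
  have hfiber : ∀ σ, shape σ = l ↔ σ.partition.parts = l.parts := fun σ => Nat.Partition.ext_iff
  rw [filter_congr fun σ _ => hfiber σ, ← card_parts_partition_eq_mul_prod_map, ← nsmul_eq_mul]
  refine sum_eq_card_nsmul fun σ hσ => ?_
  rw [multFun_eq_prod_map, (mem_filter.1 hσ).2]

theorem partsWeight_cons (g : ℕ → K) (s : Multiset ℕ) {a : ℕ} (ha : a ≠ 0) :
    (a : K) * (a ::ₘ s).count a * partsWeight g (a ::ₘ s) = g a * partsWeight g s := by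
  have hs : partsWeight g s
      = ∏ j ∈ insert a s.toFinset, (g j / j) ^ s.count j / (s.count j).factorial :=
    (prod_insert_of_eq_one_if_notMem fun h => by
      simp [Multiset.count_eq_zero.2 (mt Multiset.mem_toFinset.2 h)]).symm
  have hcons : ∀ j ∈ (insert a s.toFinset).erase a, (a ::ₘ s).count j = s.count j := fun j hj =>
    Multiset.count_cons_of_ne (ne_of_mem_erase hj) s
  rw [hs, partsWeight, Multiset.toFinset_cons, ← mul_prod_erase _ _ (mem_insert_self a s.toFinset),
    ← mul_prod_erase _ _ (mem_insert_self a s.toFinset),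
    prod_congr rfl fun j hj => by rw [hcons j hj], Multiset.count_cons_self, Nat.factorial_succ]
  have ha' : (a : K) ≠ 0 := Nat.cast_ne_zero.2 ha
  have hcount : ((s.count a : ℕ) : K) + 1 ≠ 0 := Nat.cast_add_one_ne_zero _
  have hfact : ((s.count a).factorial : K) ≠ 0 := Nat.cast_ne_zero.2 (Nat.factorial_ne_zero _)
  rw [div_pow, div_pow, pow_succ, pow_succ]
  push_cast
  field_simp

theorem sum_count_mul_partsWeight (g : ℕ → K) {n a : ℕ} (ha : 1 ≤ a) (han : a ≤ n) :
    ∑ l : n.Partition, (a : K) * l.parts.count a * partsWeight g l.parts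
      = g a * ∑ l : (n - a).Partition, partsWeight g l.parts := by
  have hsupp : ∑ l : n.Partition, (a : K) * l.parts.count a * partsWeight g l.parts
      = ∑ l : {l : n.Partition // a ∈ l.parts},
          (a : K) * l.1.parts.count a * partsWeight g l.1.parts := by
    rw [← sum_subtype {l : n.Partition | a ∈ l.parts} (by simp) fun l =>
      (a : K) * l.parts.count a * partsWeight g l.parts]
    refine (sum_subset (subset_univ _) fun l _ hl => ?_).symm
    simp [Multiset.count_eq_zero.2 fun h => hl (by simpa using h)]
  rw [hsupp, mul_sum, ← (Nat.Partition.partitionWithPartEquiv ha han).symm.sum_comp]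
  refine sum_congr rfl fun l _ => ?_
  rw [Nat.Partition.partitionWithPartEquiv_symm_apply_parts, partsWeight_cons g _ (by omega)]

theorem mul_sum_partsWeight (g : ℕ → K) (n : ℕ) :
    (n : K) * ∑ l : n.Partition, partsWeight g l.parts
      = ∑ a ∈ Icc 1 n, g a * ∑ l : (n - a).Partition, partsWeight g l.parts := by
  have hsize : ∀ l : n.Partition, (n : K) = ∑ a ∈ Icc 1 n, (a : K) * l.parts.count a := by
    intro l
    have h : n = ∑ a ∈ Icc 1 n, a * l.parts.count a := by
      conv_lhs => rw [← l.parts_sum, sum_multiset_count]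
      simp only [smul_eq_mul, mul_comm (l.parts.count _)]
      refine sum_subset (fun a ha => ?_) fun a _ ha => ?_
      · have ha := Multiset.mem_toFinset.1 ha
        exact mem_Icc.2 ⟨l.parts_pos ha, l.le_of_mem_parts ha⟩
      · rw [Multiset.count_eq_zero.2 (mt Multiset.mem_toFinset.2 ha), mul_zero]
    exact_mod_cast congrArg (Nat.cast : ℕ → K) h
  calc (n : K) * ∑ l : n.Partition, partsWeight g l.parts
      = ∑ l : n.Partition, ∑ a ∈ Icc 1 n, (a : K) * l.parts.count a * partsWeight g l.parts := by
        rw [mul_sum]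
        exact sum_congr rfl fun l _ => by rw [← sum_mul, ← hsize]
    _ = _ := by
        rw [sum_comm]
        exact sum_congr rfl fun a ha =>
          sum_count_mul_partsWeight g (mem_Icc.1 ha).1 (mem_Icc.1 ha).2

end CycleCounting

/-- `c` is the coefficient sequence of `exp (∑ u i * z ^ (i + 1) / (i + 1))`, as expressed by the
recursion that comes from the logarithmic derivative. Indices of `u` are shifted by one: `u i` is
the coefficient usually called `u (i + 1)`. -/
def IsExpCoeff {K : Type*} [Field K] (u c : ℕ → K) : Prop :=
  c 0 = 1 ∧ ∀ n : ℕ, (n : K) * c n = ∑ k ∈ Finset.range n, u (n - 1 - k) * c k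

theorem isExpCoeff_sum_multFun {K : Type*} [Field K] [CharZero K] (g : ℕ → K) :
    IsExpCoeff (fun i => g (i + 1))
      fun n => (∑ σ : Equiv.Perm (Fin n), multFun g σ) / n.factorial := by
  refine ⟨by simp [multFun], fun n => ?_⟩
  simp only [sum_multFun_div_factorial, mul_sum_partsWeight]
  refine Finset.sum_bij' (fun a _ => n - a) (fun k _ => n - k) ?_ ?_ ?_ ?_ ?_
  all_goals intro a ha; simp only [Finset.mem_Icc, Finset.mem_range] at ha ⊢
  any_goals omega
  rw [show n - 1 - (n - a) + 1 = a by omega]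

section PowerSeries

open Finset.HasAntidiagonal (antidiagonal mem_antidiagonal)

variable {𝕜 : Type*} [RCLike 𝕜]

/-- The sum of the power series with coefficients `c`; junk outside the disc of convergence. -/
noncomputable def genSeries (c : ℕ → 𝕜) (z : 𝕜) : 𝕜 := ∑' n, c n * z ^ n

/-- The primitive `∑ u n * z ^ (n + 1) / (n + 1)` of `genSeries u`; its exponential is the
generating series of the sequence `c` with `IsExpCoeff u c`. -/
noncomputable def logSeries (u : ℕ → 𝕜) (z : 𝕜) : 𝕜 := ∑' n : ℕ, u n * z ^ (n + 1) / (n + 1)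

/-- The power series with coefficients `c` converges absolutely on the open unit ball. -/
def SummableOnUnitBall (c : ℕ → 𝕜) : Prop :=
  ∀ r : ℝ, 0 ≤ r → r < 1 → Summable fun n => ‖c n‖ * r ^ n

theorem genSeries_zero (c : ℕ → 𝕜) : genSeries c 0 = c 0 := by
  rw [genSeries, tsum_eq_single 0 fun n hn => by simp [hn]]
  simp

theorem sum_antidiagonal_mul_pow (a b : ℕ → 𝕜) (z : 𝕜) (n : ℕ) :
    ∑ x ∈ antidiagonal n, (a x.1 * z ^ x.1) * (b x.2 * z ^ x.2)
      = (∑ x ∈ antidiagonal n, a x.1 * b x.2) * z ^ n := by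
  rw [Finset.sum_mul]
  refine Finset.sum_congr rfl fun x hx => ?_
  rw [← mem_antidiagonal.1 hx]
  ring

namespace SummableOnUnitBall

variable {c u : ℕ → 𝕜} {z : 𝕜}

theorem of_norm_le {p : ℕ → ℝ} (hp : SummableOnUnitBall p) (h : ∀ n, ‖c n‖ ≤ p n) :
    SummableOnUnitBall c := fun r hr0 hr1 =>
  (hp r hr0 hr1).of_nonneg_of_le (fun _ => by positivity) fun n => by
    gcongr
    exact (h n).trans (le_abs_self _)

theorem of_bounded {B : ℝ} (h : ∀ n, ‖u n‖ ≤ B) : SummableOnUnitBall u := fun r hr0 hr1 =>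
  ((summable_geometric_of_lt_one hr0 hr1).mul_left B).of_nonneg_of_le (fun _ => by positivity)
    fun n => by gcongr; exact h n

theorem summable_norm (hc : SummableOnUnitBall c) (hz : ‖z‖ < 1) :
    Summable fun n => ‖c n * z ^ n‖ := by
  simpa only [norm_mul, norm_pow] using hc ‖z‖ (norm_nonneg z) hz

theorem hasSum_genSeries (hc : SummableOnUnitBall c) (hz : ‖z‖ < 1) :
    HasSum (fun n => c n * z ^ n) (genSeries c z) :=
  (hc.summable_norm hz).of_norm.hasSum

theorem summable_logSeries (hu : SummableOnUnitBall u) (hz : ‖z‖ < 1) :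
    Summable fun n : ℕ => u n * z ^ (n + 1) / (n + 1) := by
  refine .of_norm_bounded (hu.summable_norm hz) fun n => ?_
  have hn : ‖(n : 𝕜) + 1‖ = n + 1 := by exact_mod_cast RCLike.norm_natCast (K := 𝕜) (n + 1)
  rw [norm_div, hn, pow_succ, ← mul_assoc, norm_mul _ z]
  refine (div_le_self (by positivity) (by simp)).trans ?_
  exact mul_le_of_le_one_right (norm_nonneg _) hz.le

theorem hasDerivAt_logSeries (hu : SummableOnUnitBall u) (hz : ‖z‖ < 1) :
    HasDerivAt (logSeries u) (genSeries u z) z := by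
  obtain ⟨r, hzr, hr⟩ := exists_between hz
  have hr0 : 0 < r := (norm_nonneg z).trans_lt hzr
  refine hasDerivAt_tsum_of_isPreconnected (t := Metric.ball (0 : 𝕜) r) (y₀ := 0)
    (g := fun n w => u n * w ^ (n + 1) / ((n : 𝕜) + 1)) (g' := fun n w => u n * w ^ n)
    (hu r hr0.le hr) Metric.isOpen_ball (convex_ball _ _).isPreconnected (fun n w _ => ?_)
    (fun n w hw => ?_) (by simpa using hr0) (by simp) (by simpa using hzr)
  · refine (((hasDerivAt_pow (n + 1) w).const_mul (u n)).div_const ((n : 𝕜) + 1)).congr_deriv ?_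
    have : (n : 𝕜) + 1 ≠ 0 := Nat.cast_add_one_ne_zero n
    push_cast
    field_simp
  · have hw : ‖w‖ ≤ r := by simpa using (Metric.mem_ball.1 hw).le
    rw [norm_mul, norm_pow]
    gcongr

theorem genSeries_mul_genSeries (hu : SummableOnUnitBall u) (hc : SummableOnUnitBall c)
    (hz : ‖z‖ < 1) : genSeries u z * genSeries c z
      = genSeries (fun n => ∑ x ∈ antidiagonal n, u x.1 * c x.2) z := by
  unfold genSeries
  rw [tsum_mul_tsum_eq_tsum_sum_antidiagonal_of_summable_norm (hu.summable_norm hz)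
    (hc.summable_norm hz)]
  simp only [sum_antidiagonal_mul_pow]

theorem convolution (hu : SummableOnUnitBall u) (hc : SummableOnUnitBall c) :
    SummableOnUnitBall fun n => ∑ x ∈ antidiagonal n, u x.1 * c x.2 := by
  intro r hr0 hr1
  have hr : ‖(r : 𝕜)‖ = r := by rw [RCLike.norm_ofReal, abs_of_nonneg hr0]
  refine (summable_norm_sum_mul_antidiagonal_of_summable_norm
    (hu.summable_norm (z := (r : 𝕜)) (by rwa [hr]))
    (hc.summable_norm (z := (r : 𝕜)) (by rwa [hr]))).congr fun n => ?_
  rw [sum_antidiagonal_mul_pow, norm_mul, norm_pow, hr]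

theorem genSeries_eq_add_logSeries (hc : SummableOnUnitBall c) (hz : ‖z‖ < 1) :
    genSeries c z = c 0 + logSeries (fun n => ((n : 𝕜) + 1) * c (n + 1)) z := by
  rw [genSeries, (hc.hasSum_genSeries hz).summable.tsum_eq_zero_add, pow_zero, mul_one, logSeries]
  congr 1
  refine tsum_congr fun n => ?_
  have : (n : 𝕜) + 1 ≠ 0 := Nat.cast_add_one_ne_zero n
  field_simp

end SummableOnUnitBall

namespace IsExpCoeff

variable {u c : ℕ → 𝕜} {v p : ℕ → ℝ}

theorem norm_le (hc : IsExpCoeff u c) (hp : IsExpCoeff v p) (h : ∀ i, ‖u i‖ ≤ v i) (n : ℕ) :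
    ‖c n‖ ≤ p n := by
  induction n using Nat.strong_induction_on with
  | _ n ih =>
    rcases n.eq_zero_or_pos with rfl | hn
    · rw [hc.1, hp.1, norm_one]
    · have hn : (0 : ℝ) < n := Nat.cast_pos.2 hn
      refine le_of_mul_le_mul_left ?_ hn
      calc (n : ℝ) * ‖c n‖ = ‖∑ k ∈ Finset.range n, u (n - 1 - k) * c k‖ := by
            rw [← hc.2, norm_mul, RCLike.norm_natCast]
        _ ≤ ∑ k ∈ Finset.range n, v (n - 1 - k) * p k := by
            refine norm_sum_le_of_le _ fun k hk => ?_
            rw [norm_mul]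
            exact mul_le_mul (h _) (ih k (Finset.mem_range.1 hk)) (norm_nonneg _)
              ((norm_nonneg _).trans (h _))
        _ = n * p n := (hp.2 n).symm

theorem pos (hp : IsExpCoeff v p) (hv : ∀ i, 0 < v i) (n : ℕ) : 0 < p n := by
  induction n using Nat.strong_induction_on with
  | _ n ih =>
    rcases n.eq_zero_or_pos with rfl | hn
    · exact hp.1 ▸ one_pos
    · refine pos_of_mul_pos_right (b := p n) (a := (n : ℝ)) ?_ n.cast_nonneg
      rw [hp.2]
      exact Finset.sum_pos (fun k hk => mul_pos (hv _) (ih k (Finset.mem_range.1 hk)))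
        (Finset.nonempty_range_iff.2 hn.ne')

theorem choose (k : ℕ) :
    IsExpCoeff (fun _ => ((k + 1 : ℕ) : ℝ)) fun n => ((n + k).choose k : ℝ) := by
  refine ⟨by simp, fun n => ?_⟩
  rw [← Finset.mul_sum]
  have hockey : ∑ j ∈ Finset.range n, (j + k).choose k = (n + k).choose (k + 1) := by
    rcases n with _ | n
    · simp
    · rw [Nat.sum_range_add_choose, add_right_comm]
  have hsucc := Nat.choose_succ_right_eq (n + k) k
  rw [Nat.add_sub_cancel, ← hockey] at hsucc
  have := congrArg (Nat.cast : ℕ → ℝ) hsucc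
  push_cast at this ⊢
  linarith

theorem summableOnUnitBall (hc : IsExpCoeff u c) {B : ℝ} (hu : ∀ i, ‖u i‖ ≤ B) :
    SummableOnUnitBall c := by
  have hk : ∀ i, ‖u i‖ ≤ ((⌈B⌉₊ + 1 : ℕ) : ℝ) := fun i => by
    push_cast
    linarith [hu i, Nat.le_ceil B]
  refine SummableOnUnitBall.of_norm_le (fun r hr0 hr1 => ?_) (hc.norm_le (choose ⌈B⌉₊) hk)
  simpa using summable_choose_mul_geometric_of_norm_lt_one ⌈B⌉₊
    (by rwa [Real.norm_of_nonneg hr0] : ‖r‖ < 1)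

theorem succ_mul_eq_sum_antidiagonal (hc : IsExpCoeff u c) (n : ℕ) :
    ((n : 𝕜) + 1) * c (n + 1) = ∑ x ∈ antidiagonal n, u x.1 * c x.2 := by
  rw [← Finset.Nat.sum_antidiagonal_swap, Finset.Nat.sum_antidiagonal_eq_sum_range_succ_mk]
  exact_mod_cast hc.2 (n + 1)

theorem hasDerivAt_genSeries (hc : IsExpCoeff u c) {B : ℝ} (hu : ∀ i, ‖u i‖ ≤ B) {z : 𝕜}
    (hz : ‖z‖ < 1) : HasDerivAt (genSeries c) (genSeries u z * genSeries c z) z := by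
  have hsu := SummableOnUnitBall.of_bounded hu
  have hsc := hc.summableOnUnitBall hu
  have hderiv := (hsu.convolution hsc).hasDerivAt_logSeries hz
  rw [← hsu.genSeries_mul_genSeries hsc hz] at hderiv
  refine (hderiv.const_add (c 0)).congr_of_eventuallyEq ?_
  filter_upwards [Metric.isOpen_ball.mem_nhds (mem_ball_zero_iff.2 hz)] with w hw
  rw [hsc.genSeries_eq_add_logSeries (mem_ball_zero_iff.1 hw)]
  simp only [hc.succ_mul_eq_sum_antidiagonal]

theorem genSeries_eq_exp (hc : IsExpCoeff u c) {B : ℝ} (hu : ∀ i, ‖u i‖ ≤ B) {z : 𝕜}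
    (hz : ‖z‖ < 1) : genSeries c z = NormedSpace.exp (logSeries u z) := by
  have hderiv : ∀ w ∈ Metric.ball (0 : 𝕜) 1,
      HasDerivAt (fun w => NormedSpace.exp (-logSeries u w) * genSeries c w) 0 w := fun w hw => by
    have hw := mem_ball_zero_iff.1 hw
    have hlog := (SummableOnUnitBall.of_bounded hu).hasDerivAt_logSeries hw
    refine ((hasDerivAt_exp.comp w hlog.neg).mul
      (hc.hasDerivAt_genSeries hu hw)).congr_deriv ?_
    simp only [Function.comp_apply, Pi.neg_apply]
    ring
  have hconst : NormedSpace.exp (-logSeries u z) * genSeries c z = 1 := by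
    have h := Metric.isOpen_ball.is_const_of_deriv_eq_zero (convex_ball (0 : 𝕜) 1).isPreconnected
      (fun w hw => (hderiv w hw).differentiableAt.differentiableWithinAt)
      (fun w hw => (hderiv w hw).deriv) (mem_ball_zero_iff.2 hz) (Metric.mem_ball_self one_pos)
    simpa [genSeries_zero, hc.1, logSeries] using h
  rw [NormedSpace.exp_neg] at hconst
  exact (inv_mul_eq_one₀ (NormedSpace.isUnit_exp _).ne_zero).1 hconst |>.symm

end IsExpCoeff

end PowerSeries

section Growth

variable {𝕜 : Type*} [RCLike 𝕜]

theorem logSeries_const (b : ℝ) {s : ℝ} (hs0 : 0 ≤ s) (hs1 : s < 1) :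
    logSeries (fun _ => b) s = -b * Real.log (1 - s) := by
  have h := (Real.hasSum_pow_div_log_of_abs_lt_one (by rwa [abs_of_nonneg hs0])).mul_left b
  simpa only [logSeries, mul_div_assoc, mul_neg, neg_mul] using h.tsum_eq

theorem norm_logSeries_sub_le {a : ℕ → 𝕜} {w : ℕ → ℝ} (hw : SummableOnUnitBall w)
    (haw : ∀ i, ‖a i‖ ≤ w i) {s r : ℝ} (hs0 : 0 ≤ s) (hsr : s ≤ r) (hr1 : r < 1) :
    ‖logSeries a (r : 𝕜) - logSeries a (s : 𝕜)‖ ≤ logSeries w r - logSeries w s := by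
  have ha : SummableOnUnitBall a := hw.of_norm_le haw
  have hnorm : ∀ {t : ℝ}, 0 ≤ t → t ≤ r → ‖t‖ < 1 := fun ht0 htr => by
    rw [Real.norm_of_nonneg ht0]
    exact htr.trans_lt hr1
  have hnorm' : ∀ {t : ℝ}, 0 ≤ t → t ≤ r → ‖(t : 𝕜)‖ < 1 := fun ht0 htr => by
    simpa using hnorm ht0 htr
  have hr0 := hs0.trans hsr
  have hdiff := ((hw.summable_logSeries (hnorm hr0 le_rfl)).hasSum.sub
    (hw.summable_logSeries (hnorm hs0 hsr)).hasSum)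
  unfold logSeries
  rw [← (ha.summable_logSeries (hnorm' hr0 le_rfl)).tsum_sub
    (ha.summable_logSeries (hnorm' hs0 hsr))]
  refine tsum_of_norm_bounded hdiff fun i => ?_
  have hpow : s ^ (i + 1) ≤ r ^ (i + 1) := by gcongr
  have hcast : a i * (r : 𝕜) ^ (i + 1) / (i + 1) - a i * (s : 𝕜) ^ (i + 1) / (i + 1)
      = a i * ((r ^ (i + 1) - s ^ (i + 1)) / (i + 1) : ℝ) := by
    push_cast
    ring
  rw [hcast, norm_mul, RCLike.norm_ofReal,
    abs_of_nonneg (div_nonneg (sub_nonneg.2 hpow) (by positivity))]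
  calc ‖a i‖ * ((r ^ (i + 1) - s ^ (i + 1)) / (i + 1))
      ≤ w i * ((r ^ (i + 1) - s ^ (i + 1)) / (i + 1)) := by
        gcongr
        exact haw i
    _ = _ := by ring

theorem logSeries_sub_le_logSeries_sub {v w : ℕ → ℝ} (hw : SummableOnUnitBall w)
    (hv : ∀ i, 0 ≤ v i) (hvw : ∀ i, v i ≤ w i) {s r : ℝ} (hs0 : 0 ≤ s) (hsr : s ≤ r)
    (hr1 : r < 1) : logSeries v r - logSeries v s ≤ logSeries w r - logSeries w s :=
  (le_abs_self _).trans <| norm_logSeries_sub_le (𝕜 := ℝ) hw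
    (fun i => by rw [Real.norm_of_nonneg (hv i)]; exact hvw i) hs0 hsr hr1

theorem tendsto_one_sub_nhdsLT_one : Tendsto (fun s : ℝ => 1 - s) (𝓝[<] 1) (𝓝[>] 0) :=
  tendsto_nhdsWithin_of_tendsto_nhds_of_eventually_within _
    (((continuous_sub_left (1 : ℝ)).tendsto' 1 0 (sub_self 1)).mono_left nhdsWithin_le_nhds)
    (by filter_upwards [self_mem_nhdsWithin] with s hs using sub_pos.2 (Set.mem_Iio.1 hs))

namespace IsExpCoeff

variable {v p : ℕ → ℝ} {θ B s r : ℝ}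

theorem summableOnUnitBall_of_nonneg (hp : IsExpCoeff v p) (hv : ∀ i, 0 ≤ v i)
    (hB : ∀ i, v i ≤ B) : SummableOnUnitBall p :=
  hp.summableOnUnitBall fun i => by rw [Real.norm_of_nonneg (hv i)]; exact hB i

theorem genSeries_eq_realExp (hp : IsExpCoeff v p) (hv : ∀ i, 0 ≤ v i) (hB : ∀ i, v i ≤ B)
    (hs0 : 0 ≤ s) (hs1 : s < 1) : genSeries p s = Real.exp (logSeries v s) := by
  rw [Real.exp_eq_exp_ℝ]
  exact hp.genSeries_eq_exp (fun i => by rw [Real.norm_of_nonneg (hv i)]; exact hB i)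
    (by rwa [Real.norm_of_nonneg hs0])

theorem genSeries_pos (hp : IsExpCoeff v p) (hv : ∀ i, 0 ≤ v i) (hB : ∀ i, v i ≤ B)
    (hs0 : 0 ≤ s) (hs1 : s < 1) : 0 < genSeries p s := by
  rw [hp.genSeries_eq_realExp hv hB hs0 hs1]
  exact Real.exp_pos _

theorem genSeries_le_rpow_mul_of_forall_le (hp : IsExpCoeff v p) (hv : ∀ i, 0 ≤ v i)
    (hB : ∀ i, v i ≤ B) (hs0 : 0 ≤ s) (hsr : s ≤ r) (hr1 : r < 1) :
    genSeries p r ≤ ((1 - s) / (1 - r)) ^ B * genSeries p s := by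
  have hs1 := hsr.trans_lt hr1
  have hlog := logSeries_sub_le_logSeries_sub (w := fun _ => B)
    (SummableOnUnitBall.of_bounded fun _ => le_rfl) hv hB hs0 hsr hr1
  rw [logSeries_const B (hs0.trans hsr) hr1, logSeries_const B hs0 hs1] at hlog
  rw [hp.genSeries_eq_realExp hv hB (hs0.trans hsr) hr1, hp.genSeries_eq_realExp hv hB hs0 hs1,
    Real.rpow_def_of_pos (div_pos (by linarith) (by linarith)),
    Real.log_div (by linarith) (by linarith), ← Real.exp_add, Real.exp_le_exp]
  linarith

theorem genSeries_le_rpow_mul_of_forall_ge (hp : IsExpCoeff v p) (hθ : 0 ≤ θ) (hv : ∀ i, θ ≤ v i)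
    (hB : ∀ i, v i ≤ B) (hs0 : 0 ≤ s) (hsr : s ≤ r) (hr1 : r < 1) :
    genSeries p s ≤ ((1 - r) / (1 - s)) ^ θ * genSeries p r := by
  have hs1 := hsr.trans_lt hr1
  have hv0 : ∀ i, 0 ≤ v i := fun i => hθ.trans (hv i)
  have hlog := logSeries_sub_le_logSeries_sub (v := fun _ => θ) (SummableOnUnitBall.of_bounded
    fun i => by rw [Real.norm_of_nonneg (hv0 i)]; exact hB i) (fun _ => hθ) hv hs0 hsr hr1
  rw [logSeries_const θ (hs0.trans hsr) hr1, logSeries_const θ hs0 hs1] at hlog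
  rw [hp.genSeries_eq_realExp hv0 hB (hs0.trans hsr) hr1, hp.genSeries_eq_realExp hv0 hB hs0 hs1,
    Real.rpow_def_of_pos (div_pos (by linarith) (by linarith)),
    Real.log_div (by linarith) (by linarith), ← Real.exp_add, Real.exp_le_exp]
  linarith

theorem genSeries_le_two_rpow_mul (hp : IsExpCoeff v p) (hv : ∀ i, 0 ≤ v i) (hB : ∀ i, v i ≤ B)
    (hs0 : 0 ≤ s) (hs1 : s < 1) : genSeries p s ≤ 2 ^ B * genSeries p (s ^ 2) := by
  have hB0 : 0 ≤ B := (hv 0).trans (hB 0)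
  have hG := hp.genSeries_pos hv hB (sq_nonneg s) (by nlinarith)
  refine (hp.genSeries_le_rpow_mul_of_forall_le hv hB (sq_nonneg s) (by nlinarith) hs1).trans ?_
  have hratio : (1 - s ^ 2) / (1 - s) = 1 + s := by
    rw [div_eq_iff (by linarith)]
    ring
  rw [hratio]
  gcongr
  linarith

theorem tendsto_genSeries_atTop (hp : IsExpCoeff v p) (hθ : 0 < θ) (hv : ∀ i, θ ≤ v i)
    (hB : ∀ i, v i ≤ B) : Tendsto (genSeries p) (𝓝[<] 1) atTop := by
  refine tendsto_atTop_mono' _ ?_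
    ((tendsto_rpow_neg_nhdsGT_zero (neg_lt_zero.2 hθ)).comp tendsto_one_sub_nhdsLT_one)
  filter_upwards [Ioo_mem_nhdsLT (zero_lt_one (α := ℝ))] with s hs
  have h := hp.genSeries_le_rpow_mul_of_forall_ge hθ.le hv hB le_rfl hs.1.le hs.2
  rw [genSeries_zero, hp.1, sub_zero, div_one] at h
  have hpos : 0 < 1 - s := sub_pos.2 hs.2
  rw [Function.comp_apply, Real.rpow_neg hpos.le, inv_le_iff_one_le_mul₀' (by positivity)]
  exact h

theorem mul_le_mul_sum_range (hp : IsExpCoeff v p) (hv : ∀ i, 0 < v i) (hB : ∀ i, v i ≤ B)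
    (n : ℕ) : n * p n ≤ B * ∑ k ∈ Finset.range n, p k := by
  rw [hp.2, Finset.mul_sum]
  exact Finset.sum_le_sum fun k _ => mul_le_mul_of_nonneg_right (hB _) (hp.pos hv k).le

theorem mul_sum_range_le_mul (hp : IsExpCoeff v p) (hθ : 0 < θ) (hv : ∀ i, θ ≤ v i) (n : ℕ) :
    θ * ∑ k ∈ Finset.range n, p k ≤ n * p n := by
  rw [hp.2, Finset.mul_sum]
  exact Finset.sum_le_sum fun k _ =>
    mul_le_mul_of_nonneg_right (hv _) (hp.pos (fun i => hθ.trans_le (hv i)) k).le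

end IsExpCoeff

end Growth

/-- `F` oscillates by `o(1)` as `s → 1⁻` over the points `r < 1` whose distance to `1` is comparable
to that of `s`. -/
def SlowlyVaryingAtOne {E : Type*} [Norm E] [Sub E] (F : ℝ → E) : Prop :=
  ∀ L : ℝ, ∀ ε > 0, ∀ᶠ s in 𝓝[<] (1 : ℝ),
    ∀ r < 1, 1 - r ≤ L * (1 - s) → 1 - s ≤ L * (1 - r) → ‖F r - F s‖ ≤ ε

section SlowVariation

theorem eventually_mul_one_sub_lt (L : ℝ) {ε : ℝ} (hε : 0 < ε) :
    ∀ᶠ s in 𝓝[<] (1 : ℝ), L * (1 - s) < ε := by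
  have h := (tendsto_one_sub_nhdsLT_one.mono_right nhdsWithin_le_nhds).const_mul L
  rw [mul_zero] at h
  exact h.eventually_lt_const hε

theorem pow_sub_pow_div_le {s r : ℝ} (hs0 : 0 ≤ s) (hsr : s ≤ r) (hr1 : r ≤ 1) (i : ℕ) :
    (r ^ (i + 1) - s ^ (i + 1)) / (i + 1) ≤ r - s := by
  have hr0 := hs0.trans hsr
  rw [div_le_iff₀ (by positivity)]
  calc r ^ (i + 1) - s ^ (i + 1)
      ≤ |r - s| * (i + 1 : ℕ) * max |r| |s| ^ (i + 1 - 1) :=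
        (le_abs_self _).trans (abs_pow_sub_pow_le ..)
    _ ≤ |r - s| * (i + 1 : ℕ) * 1 := by
        gcongr
        exact pow_le_one₀ (by positivity) (by simp [abs_of_nonneg, *])
    _ = (r - s) * (i + 1) := by
        rw [mul_one, abs_of_nonneg (sub_nonneg.2 hsr)]
        push_cast
        ring

variable {𝕜 : Type*} [RCLike 𝕜] {a : ℕ → 𝕜}

theorem logSeries_add {u w : ℕ → 𝕜} (hu : SummableOnUnitBall u) (hw : SummableOnUnitBall w) {z : 𝕜}
    (hz : ‖z‖ < 1) : logSeries (fun i => u i + w i) z = logSeries u z + logSeries w z := by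
  simp only [logSeries, add_mul, add_div]
  exact (hu.summable_logSeries hz).tsum_add (hw.summable_logSeries hz)

theorem logSeries_ite_lt_sub_le {D : ℝ} (hD : 0 ≤ D) (J : ℕ) {s r : ℝ} (hs0 : 0 ≤ s)
    (hsr : s ≤ r) (hr1 : r ≤ 1) :
    logSeries (fun i => if i < J then D else 0) r - logSeries (fun i => if i < J then D else 0) s
      ≤ J * D * (r - s) := by
  have hfin : ∀ t : ℝ, logSeries (fun i => if i < J then D else 0) t
      = ∑ i ∈ Finset.range J, D * (t ^ (i + 1) / (i + 1)) := fun t => by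
    rw [logSeries, tsum_eq_sum (s := Finset.range J) fun i hi => by
      rw [if_neg (mt Finset.mem_range.2 hi), zero_mul, zero_div]]
    exact Finset.sum_congr rfl fun i hi => by rw [if_pos (Finset.mem_range.1 hi), mul_div_assoc]
  rw [hfin, hfin, ← Finset.sum_sub_distrib]
  calc _ ≤ ∑ _i ∈ Finset.range J, D * (r - s) := by
        refine Finset.sum_le_sum fun _ _ => ?_
        rw [← mul_sub, ← sub_div]
        exact mul_le_mul_of_nonneg_left (pow_sub_pow_div_le hs0 hsr hr1 _) hD
    _ = J * D * (r - s) := by simp [mul_assoc]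

theorem norm_logSeries_sub_le_log_add {η D : ℝ} {J : ℕ} (hη : 0 ≤ η)
    (hD : ∀ i, ‖a i‖ ≤ D) (hJ : ∀ i, J ≤ i → ‖a i‖ ≤ η) {s r : ℝ} (hs0 : 0 ≤ s) (hsr : s ≤ r)
    (hr1 : r < 1) : ‖logSeries a (r : 𝕜) - logSeries a (s : 𝕜)‖
      ≤ η * Real.log ((1 - s) / (1 - r)) + J * D * (r - s) := by
  have hD0 : 0 ≤ D := (norm_nonneg _).trans (hD 0)
  have hr0 := hs0.trans hsr
  have hs1 := hsr.trans_lt hr1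
  have hconst : SummableOnUnitBall fun _ : ℕ => η := .of_bounded fun _ => le_rfl
  have htrunc : SummableOnUnitBall fun i : ℕ => if i < J then D else 0 :=
    .of_bounded (B := D) fun i => by split_ifs <;> simp [abs_of_nonneg hD0, hD0]
  have hsum : SummableOnUnitBall fun i : ℕ => η + if i < J then D else 0 :=
    .of_bounded (B := η + D) fun i => by
      rw [Real.norm_of_nonneg (by positivity)]
      split_ifs <;> simp [hD0]
  have hbound : ∀ i, ‖a i‖ ≤ η + if i < J then D else 0 := fun i => by
    rcases lt_or_ge i J with h | h
    · simpa [h] using (hD i).trans (le_add_of_nonneg_left hη)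
    · simpa [h.not_gt] using hJ i h
  refine (norm_logSeries_sub_le hsum hbound hs0 hsr hr1).trans ?_
  rw [logSeries_add hconst htrunc (by rwa [Real.norm_of_nonneg hr0]), logSeries_const η hr0 hr1,
    logSeries_add hconst htrunc (by rwa [Real.norm_of_nonneg hs0]), logSeries_const η hs0 hs1,
    Real.log_div (by linarith) (by linarith)]
  linarith [logSeries_ite_lt_sub_le hD0 J hs0 hsr hr1.le]

theorem slowlyVaryingAtOne_logSeries (ha : Tendsto a atTop (𝓝 0)) :
    SlowlyVaryingAtOne fun s : ℝ => logSeries a (s : 𝕜) := by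
  intro L ε hε
  obtain ⟨D, hD⟩ := ha.norm.bddAbove_range
  replace hD : ∀ i, ‖a i‖ ≤ D := fun i => hD ⟨i, rfl⟩
  have hD0 : 0 ≤ D := (norm_nonneg _).trans (hD 0)
  set η := ε / (2 * (|Real.log L| + 1)) with hη
  have hη0 : 0 < η := by positivity
  obtain ⟨J, hJ⟩ :=
    eventually_atTop.1 (ha.norm.eventually_le_const (by rwa [norm_zero] : ‖(0 : 𝕜)‖ < η))
  have hclose : ∀ {x y : ℝ}, 0 ≤ x → x ≤ y → y < 1 → 1 - x ≤ L * (1 - y) →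
      J * D * (1 - x) ≤ ε / 2 → ‖logSeries a (y : 𝕜) - logSeries a (x : 𝕜)‖ ≤ ε := by
    intro x y hx hxy hy hL hsmall
    refine (norm_logSeries_sub_le_log_add (by positivity) hD hJ hx hxy hy).trans ?_
    have hlog : Real.log ((1 - x) / (1 - y)) ≤ |Real.log L| + 1 := by
      refine (Real.log_le_log (div_pos (by linarith) (by linarith)) ?_).trans
        ((le_abs_self _).trans (le_add_of_nonneg_right zero_le_one))
      rwa [div_le_iff₀ (by linarith)]
    calc η * Real.log ((1 - x) / (1 - y)) + J * D * (y - x)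
        ≤ η * (|Real.log L| + 1) + J * D * (1 - x) := by gcongr
      _ ≤ ε / 2 + ε / 2 := by
          gcongr
          rw [hη]
          field_simp
          exact le_rfl
      _ = ε := add_halves ε
  filter_upwards [Ioo_mem_nhdsLT zero_lt_one, eventually_mul_one_sub_lt L one_pos,
    eventually_mul_one_sub_lt (J * D) (half_pos hε),
    eventually_mul_one_sub_lt (J * D * L) (half_pos hε)] with s hs hL hJs hJL r hr h₁ h₂
  rcases le_total s r with hsr | hrs
  · exact hclose hs.1.le hsr hr h₂ hJs.le
  · rw [norm_sub_rev]
    refine hclose (by linarith) hrs hs.2 h₁ (le_trans ?_ hJL.le)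
    rw [mul_assoc (J * D : ℝ)]
    gcongr

theorem SlowlyVaryingAtOne.cexp {T : ℝ → ℂ} (hT : SlowlyVaryingAtOne T) {M : ℝ}
    (hM : ∀ᶠ s in 𝓝[<] (1 : ℝ), ‖Complex.exp (T s)‖ ≤ M) :
    SlowlyVaryingAtOne fun s => Complex.exp (T s) := by
  intro L ε hε
  filter_upwards [hT L (min 1 (ε / (2 * max M 1))) (by positivity), hM] with s hs hMs r hr h₁ h₂
  have hdist := hs r hr h₁ h₂
  have hexp : Complex.exp (T r) - Complex.exp (T s)
      = Complex.exp (T s) * (Complex.exp (T r - T s) - 1) := by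
    rw [Complex.exp_sub]
    field_simp
  rw [hexp, norm_mul]
  calc ‖Complex.exp (T s)‖ * ‖Complex.exp (T r - T s) - 1‖
      ≤ max M 1 * (2 * (ε / (2 * max M 1))) := by
        gcongr
        · exact hMs.trans (le_max_left _ _)
        · exact (Complex.norm_exp_sub_one_le (hdist.trans (min_le_left _ _))).trans
            (mul_le_mul_of_nonneg_left (hdist.trans (min_le_right _ _)) zero_le_two)
    _ = ε := by field_simp

end SlowVariation

section AbelMean

theorem tendsto_tsum_smul_zero {ι E : Type*} [NormedAddCommGroup E] [NormedSpace ℝ E]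
    {l : Filter ι} {w : ι → ℕ → ℝ} {y : ℕ → E} {C : ℝ} (hw : ∀ᶠ i in l, ∀ k, 0 ≤ w i k)
    (hsum : ∀ᶠ i in l, Summable (w i)) (hC : ∀ᶠ i in l, ∑' k, w i k ≤ C)
    (hcol : ∀ k, Tendsto (fun i => w i k) l (𝓝 0)) (hy : Tendsto y atTop (𝓝 0)) :
    Tendsto (fun i => ∑' k, w i k • y k) l (𝓝 0) := by
  refine NormedAddGroup.tendsto_nhds_zero.2 fun ε hε => ?_
  set η := ε / (2 * (|C| + 1)) with hη
  have hη0 : 0 < η := by positivity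
  obtain ⟨N, hN⟩ :=
    eventually_atTop.1 (hy.norm.eventually_le_const (by rwa [norm_zero] : ‖(0 : E)‖ < η))
  have hhead : Tendsto (fun i => ∑ k ∈ Finset.range N, w i k * ‖y k‖) l (𝓝 0) := by
    simpa using tendsto_finsetSum (Finset.range N) fun k _ => (hcol k).mul_const ‖y k‖
  filter_upwards [hw, hsum, hC, hhead.eventually_lt_const (half_pos hε)] with i hwi hsi hCi hhi
  have hbound : ∀ k, ‖w i k • y k‖
      ≤ η * w i k + if k ∈ Finset.range N then w i k * ‖y k‖ else 0 := fun k => by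
    rw [norm_smul, Real.norm_of_nonneg (hwi k)]
    split_ifs with hk
    · exact le_add_of_nonneg_left (mul_nonneg (by positivity) (hwi k))
    · rw [add_zero, mul_comm η]
      exact mul_le_mul_of_nonneg_left (hN k (by simpa using hk)) (hwi k)
  have htail : HasSum (fun k => if k ∈ Finset.range N then w i k * ‖y k‖ else 0)
      (∑ k ∈ Finset.range N, w i k * ‖y k‖) := by
    rw [← Finset.sum_congr rfl fun k hk => if_pos hk]
    exact hasSum_sum_of_ne_finset_zero fun k hk => if_neg hk
  calc ‖∑' k, w i k • y k‖
      ≤ η * ∑' k, w i k + ∑ k ∈ Finset.range N, w i k * ‖y k‖ :=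
        tsum_of_norm_bounded ((hsi.hasSum.mul_left η).add htail) hbound
    _ ≤ η * (|C| + 1) + ∑ k ∈ Finset.range N, w i k * ‖y k‖ := by
        gcongr
        linarith [le_abs_self C]
    _ < ε / 2 + ε / 2 := by
        refine add_lt_add_of_le_of_lt (le_of_eq ?_) hhi
        rw [hη]
        field_simp
    _ = ε := add_halves ε

variable {E : Type*} [NormedAddCommGroup E] [NormedSpace ℝ E]

/-- The mean of the sequence `x` with respect to the weights `p k * s ^ k`. -/
noncomputable def abelMean (p : ℕ → ℝ) (x : ℕ → E) (s : ℝ) : E :=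
  (genSeries p s)⁻¹ • ∑' k, (p k * s ^ k) • x k

variable {p : ℕ → ℝ} {x : ℕ → E} {M s : ℝ}

theorem SummableOnUnitBall.summable_norm_smul (hp : SummableOnUnitBall p)
    (hx : ∀ k, ‖x k‖ ≤ M) (hs0 : 0 ≤ s) (hs1 : s < 1) :
    Summable fun k => ‖(p k * s ^ k) • x k‖ :=
  ((hp s hs0 hs1).mul_right M).of_nonneg_of_le (fun _ => norm_nonneg _) fun k => by
    rw [norm_smul, norm_mul, norm_pow, Real.norm_of_nonneg hs0]
    gcongr
    exact hx k

theorem genSeries_smul_abelMean (hG : genSeries p s ≠ 0) (x : ℕ → E) :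
    genSeries p s • abelMean p x s = ∑' k, (p k * s ^ k) • x k :=
  smul_inv_smul₀ hG _

theorem abelMean_const {p : ℕ → ℝ} {s : ℝ} (hG : genSeries p s ≠ 0) (b : ℝ) :
    abelMean p (fun _ => b) s = b := by
  simp only [abelMean, smul_eq_mul, tsum_mul_right]
  exact inv_mul_cancel_left₀ hG b

theorem abelMean_nonneg {x : ℕ → ℝ} (hp : ∀ k, 0 ≤ p k) (hx : ∀ k, 0 ≤ x k) (hs : 0 ≤ s) :
    0 ≤ abelMean p x s :=
  smul_nonneg (inv_nonneg.2 (tsum_nonneg fun k => mul_nonneg (hp k) (pow_nonneg hs k)))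
    (tsum_nonneg fun k => smul_nonneg (mul_nonneg (hp k) (pow_nonneg hs k)) (hx k))

theorem SummableOnUnitBall.hasSum_smul [CompleteSpace E] (hp : SummableOnUnitBall p)
    (hG : genSeries p s ≠ 0) (hx : ∀ k, ‖x k‖ ≤ M) (hs0 : 0 ≤ s) (hs1 : s < 1) :
    HasSum (fun k => (p k * s ^ k) • x k) (genSeries p s • abelMean p x s) := by
  rw [genSeries_smul_abelMean hG]
  exact (hp.summable_norm_smul hx hs0 hs1).of_norm.hasSum

namespace IsExpCoeff

variable {v : ℕ → ℝ} {θ B : ℝ}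

theorem tendsto_abelMean_zero (hp : IsExpCoeff v p) (hθ : 0 < θ) (hv : ∀ i, θ ≤ v i)
    (hB : ∀ i, v i ≤ B) (hx : Tendsto x atTop (𝓝 0)) :
    Tendsto (abelMean p x) (𝓝[<] 1) (𝓝 0) := by
  have hv0 : ∀ i, 0 < v i := fun i => hθ.trans_le (hv i)
  have hIoo := Ioo_mem_nhdsLT (zero_lt_one (α := ℝ))
  have hweight : ∀ᶠ s in 𝓝[<] (1 : ℝ), Summable fun k => (genSeries p s)⁻¹ * (p k * s ^ k) := by
    filter_upwards [hIoo] with s hs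
    exact ((hp.summableOnUnitBall_of_nonneg (fun i => (hv0 i).le) hB).hasSum_genSeries
      (by rw [Real.norm_of_nonneg hs.1.le]; exact hs.2)).summable.mul_left _
  refine (tendsto_tsum_smul_zero (C := 1) (l := 𝓝[<] (1 : ℝ)) ?_ hweight ?_ (fun k => ?_) hx).congr'
    ?_
  · filter_upwards [hIoo] with s hs k
    have := hp.genSeries_pos (fun i => (hv0 i).le) hB hs.1.le hs.2
    have := hp.pos hv0 k
    have := hs.1
    positivity
  · filter_upwards [hIoo] with s hs
    rw [tsum_mul_left]
    exact (inv_mul_cancel₀ (hp.genSeries_pos (fun i => (hv0 i).le) hB hs.1.le hs.2).ne').le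
  · have hpow : Tendsto (fun s : ℝ => p k * s ^ k) (𝓝[<] 1) (𝓝 (p k * 1 ^ k)) :=
      ((continuous_const.mul (continuous_pow k)).tendsto 1).mono_left nhdsWithin_le_nhds
    simpa using (tendsto_inv_atTop_zero.comp (hp.tendsto_genSeries_atTop hθ hv hB)).mul hpow
  · filter_upwards with s
    simp only [abelMean, mul_smul, tsum_const_smul'']

end IsExpCoeff

end AbelMean

section ExpRadius

/-- The radius `e ^ (-c / n)`, whose `n`-th power is `e ^ (-c)`; it is `1` for `n = 0`. -/
noncomputable def expRadius (c : ℝ) (n : ℕ) : ℝ := Real.exp (-(c / n))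

theorem expRadius_pos (c : ℝ) (n : ℕ) : 0 < expRadius c n := Real.exp_pos _

theorem expRadius_lt_one {c : ℝ} (hc : 0 < c) {n : ℕ} (hn : 0 < n) : expRadius c n < 1 :=
  Real.exp_lt_one_iff.2 (neg_lt_zero.2 (by positivity))

theorem expRadius_pow_self (c : ℝ) {n : ℕ} (hn : 0 < n) :
    expRadius c n ^ n = Real.exp (-c) := by
  rw [expRadius, ← Real.exp_nat_mul]
  congr 1
  field_simp

theorem tendsto_expRadius {c : ℝ} (hc : 0 < c) :
    Tendsto (fun n : ℕ => expRadius c n) atTop (𝓝[<] 1) := by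
  refine tendsto_nhdsWithin_of_tendsto_nhds_of_eventually_within _ ?_ ?_
  · simpa [expRadius] using (tendsto_const_div_atTop_nhds_zero_nat c).neg.rexp
  · filter_upwards [eventually_gt_atTop 0] with n hn
    exact expRadius_lt_one hc hn

theorem expRadius_le_one {c : ℝ} (hc : 0 ≤ c) (n : ℕ) : expRadius c n ≤ 1 :=
  Real.exp_le_one_iff.2 (neg_nonpos.2 (by positivity))

theorem expRadius_pow_le_one {c : ℝ} (hc : 0 ≤ c) (n k : ℕ) : expRadius c n ^ k ≤ 1 :=
  pow_le_one₀ (expRadius_pos c n).le (expRadius_le_one hc n)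

theorem exp_neg_le_expRadius_pow {c : ℝ} (hc : 0 ≤ c) {n k : ℕ} (hk : k < n) :
    Real.exp (-c) ≤ expRadius c n ^ k := by
  rw [← expRadius_pow_self c (k.zero_le.trans_lt hk)]
  exact pow_le_pow_of_le_one (expRadius_pos c n).le (expRadius_le_one hc n) hk.le

end ExpRadius

section Concentration

theorem exp_neg_le_one_sub_half {x : ℝ} (hx0 : 0 ≤ x) (hx1 : x ≤ 1) :
    Real.exp (-x) ≤ 1 - x / 2 := by
  rw [Real.exp_neg, inv_le_comm₀ (Real.exp_pos x) (by linarith)]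
  refine le_trans ?_ (Real.add_one_le_exp x)
  rw [inv_le_iff_one_le_mul₀ (by linarith)]
  nlinarith

theorem sqrt_pow_le_exp {s c : ℝ} {k : ℕ} (hc : c ≤ k * (1 - s)) :
    √s ^ k ≤ Real.exp (-(c / 2)) := by
  have hsqrt : √s ≤ Real.exp (-(1 - s) / 2) := by
    rw [Real.sqrt_le_iff, ← Real.exp_nat_mul]
    refine ⟨(Real.exp_pos _).le, le_of_eq_of_le ?_ (Real.add_one_le_exp _)⟩
    push_cast
    ring
  calc √s ^ k ≤ Real.exp (-(1 - s) / 2) ^ k := by gcongr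
    _ = Real.exp (k * (-(1 - s) / 2)) := (Real.exp_nat_mul _ _).symm
    _ ≤ Real.exp (-(c / 2)) := Real.exp_le_exp.2 (by linarith)

/-- The mass of the weights `s ^ k` outside the window `1 / L ≤ k * (1 - s) ≤ L` is controlled by
larger geometric weights: of ratio `exp (-(L * (1 - s)))` below and of ratio `√s` above. -/
theorem pow_mul_le_of_window {L M ε s y : ℝ} {k : ℕ} (hs0 : 0 ≤ s) (hs1 : s < 1)
    (hy0 : 0 ≤ y) (hyM : y ≤ M)
    (hyε : 1 ≤ L * (k * (1 - s)) → k * (1 - s) ≤ L → y ≤ ε) (hε : 0 ≤ ε) :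
    s ^ k * y ≤ ε * s ^ k + M * Real.exp 1 * Real.exp (-(L * (1 - s))) ^ k
      + M * Real.exp (-(L / 2)) * √s ^ k := by
  have hM := hy0.trans hyM
  have hlow : 0 ≤ M * Real.exp 1 * Real.exp (-(L * (1 - s))) ^ k := by positivity
  have hhigh : 0 ≤ M * Real.exp (-(L / 2)) * √s ^ k := by positivity
  have hmid : 0 ≤ ε * s ^ k := by positivity
  rcases lt_or_ge (L * (k * (1 - s))) 1 with hk | hk
  · have hexp : 1 ≤ Real.exp 1 * Real.exp (-(L * (1 - s))) ^ k := by
      rw [← Real.exp_nat_mul, ← Real.exp_add, Real.one_le_exp_iff]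
      linarith
    have : s ^ k * y ≤ M * (Real.exp 1 * Real.exp (-(L * (1 - s))) ^ k) :=
      calc s ^ k * y ≤ 1 * M := by gcongr; exact pow_le_one₀ hs0 hs1.le
        _ ≤ _ := by rw [one_mul]; exact le_mul_of_one_le_right hM hexp
    linarith
  rcases le_or_gt (k * (1 - s)) L with hL | hL
  · have : s ^ k * y ≤ ε * s ^ k := by
      rw [mul_comm]
      gcongr
      exact hyε hk hL
    linarith
  · have : s ^ k * y ≤ M * Real.exp (-(L / 2)) * √s ^ k :=
      calc s ^ k * y = √s ^ k * √s ^ k * y := by rw [← mul_pow, Real.mul_self_sqrt hs0]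
        _ ≤ Real.exp (-(L / 2)) * √s ^ k * M := by gcongr; exact sqrt_pow_le_exp hL.le
        _ = _ := by ring
    linarith

namespace IsExpCoeff

variable {v p : ℕ → ℝ} {θ B L M ε s : ℝ}

theorem genSeries_exp_neg_le (hp : IsExpCoeff v p) (hθ : 0 < θ) (hv : ∀ i, θ ≤ v i)
    (hB : ∀ i, v i ≤ B) (hs1 : s < 1) (hL : 2 ≤ L) (hLs : L * (1 - s) ≤ 1) :
    genSeries p (Real.exp (-(L * (1 - s)))) ≤ (2 / L) ^ θ * genSeries p s := by
  have hLs0 : 0 ≤ L * (1 - s) := mul_nonneg (by linarith) (by linarith)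
  have hexp := exp_neg_le_one_sub_half hLs0 hLs
  have hle : Real.exp (-(L * (1 - s))) ≤ s := by nlinarith
  have hs0 := (Real.exp_pos _).le.trans hle
  refine (hp.genSeries_le_rpow_mul_of_forall_ge hθ.le hv hB (Real.exp_pos _).le hle hs1).trans ?_
  have hG := (hp.genSeries_pos (fun i => hθ.le.trans (hv i)) hB hs0 hs1).le
  have hratio : (1 - s) / (1 - Real.exp (-(L * (1 - s)))) ≤ 2 / L := by
    rw [div_le_div_iff₀ (by linarith) (by linarith)]
    linarith
  exact mul_le_mul_of_nonneg_right (Real.rpow_le_rpow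
    (div_nonneg (by linarith) (by linarith)) hratio hθ.le) hG

theorem abelMean_le_of_window (hp : IsExpCoeff v p) (hθ : 0 < θ) (hv : ∀ i, θ ≤ v i)
    (hB : ∀ i, v i ≤ B) (hs0 : 0 ≤ s) (hs1 : s < 1) (hL : 2 ≤ L) (hLs : L * (1 - s) ≤ 1)
    {x : ℕ → ℝ} (hx0 : ∀ k, 0 ≤ x k) (hxM : ∀ k, x k ≤ M) (hε : 0 ≤ ε)
    (hxε : ∀ k : ℕ, 1 ≤ L * (k * (1 - s)) → k * (1 - s) ≤ L → x k ≤ ε) :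
    abelMean p x s
      ≤ ε + M * (Real.exp 1 * (2 / L) ^ θ + Real.exp (-(L / 2)) * 2 ^ B) := by
  have hv0 : ∀ i, 0 < v i := fun i => hθ.trans_le (hv i)
  have hM := (hx0 0).trans (hxM 0)
  have hsum := hp.summableOnUnitBall_of_nonneg (fun i => (hv0 i).le) hB
  have hhas : ∀ {r : ℝ}, 0 ≤ r → r < 1 → HasSum (fun k => p k * r ^ k) (genSeries p r) :=
    fun hr0 hr1 => hsum.hasSum_genSeries (by rwa [Real.norm_of_nonneg hr0])
  have hlow1 : Real.exp (-(L * (1 - s))) < 1 :=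
    Real.exp_lt_one_iff.2 (neg_lt_zero.2 (mul_pos (by linarith) (by linarith)))
  have hsqrt1 : √s < 1 := by rwa [Real.sqrt_lt' one_pos, one_pow]
  have hG := hp.genSeries_pos (fun i => (hv0 i).le) hB hs0 hs1
  have hupper := hp.genSeries_le_two_rpow_mul (fun i => (hv0 i).le) hB (Real.sqrt_nonneg s) hsqrt1
  rw [Real.sq_sqrt hs0] at hupper
  have htsum : ∑' k, (p k * s ^ k) • x k ≤ ε * genSeries p s
      + M * Real.exp 1 * genSeries p (Real.exp (-(L * (1 - s))))
      + M * Real.exp (-(L / 2)) * genSeries p (√s) := by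
    have hleft := (hsum.summable_norm_smul (M := M) (x := x) (fun k => by
      rw [Real.norm_of_nonneg (hx0 k)]; exact hxM k) hs0 hs1).of_norm
    have hright := (((hhas hs0 hs1).mul_left ε).add ((hhas (Real.exp_pos _).le hlow1).mul_left
      (M * Real.exp 1))).add ((hhas (Real.sqrt_nonneg s) hsqrt1).mul_left (M * Real.exp (-(L / 2))))
    refine hasSum_le (fun k => ?_) hleft.hasSum hright
    have := mul_le_mul_of_nonneg_left
      (pow_mul_le_of_window hs0 hs1 (hx0 k) (hxM k) (hxε k) hε) (hp.pos hv0 k).le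
    rw [smul_eq_mul, mul_assoc]
    exact this.trans_eq (by ring)
  rw [abelMean, smul_eq_mul, inv_mul_le_iff₀ hG]
  calc _ ≤ _ := htsum
    _ ≤ ε * genSeries p s + M * Real.exp 1 * ((2 / L) ^ θ * genSeries p s)
          + M * Real.exp (-(L / 2)) * (2 ^ B * genSeries p s) := by
        gcongr
        exact hp.genSeries_exp_neg_le hθ hv hB hs1 hL hLs
    _ = _ := by ring

theorem tendsto_abelMean_norm_sub {E : Type*} [NormedAddCommGroup E] {F : ℝ → E}
    (hp : IsExpCoeff v p) (hθ : 0 < θ) (hv : ∀ i, θ ≤ v i) (hB : ∀ i, v i ≤ B)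
    (hF : SlowlyVaryingAtOne F)
    (hM : ∀ᶠ s in 𝓝[<] (1 : ℝ), ∀ k : ℕ, ‖F (expRadius 1 k) - F s‖ ≤ M) :
    Tendsto (fun s => abelMean p (fun k : ℕ => ‖F (expRadius 1 k) - F s‖) s)
      (𝓝[<] 1) (𝓝 0) := by
  refine NormedAddGroup.tendsto_nhds_zero.2 fun ε hε => ?_
  have htails : Tendsto (fun L : ℝ =>
      M * (Real.exp 1 * (2 / L) ^ θ + Real.exp (-(L / 2)) * 2 ^ B)) atTop (𝓝 0) := by
    have h₁ : Tendsto (fun L : ℝ => (2 / L) ^ θ) atTop (𝓝 0) := by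
      simpa [hθ.ne'] using (tendsto_id.const_div_atTop (2 : ℝ)).rpow_const (Or.inr hθ.le)
    have h₂ : Tendsto (fun L : ℝ => Real.exp (-(L / 2))) atTop (𝓝 0) :=
      Real.tendsto_exp_neg_atTop_nhds_zero.comp (tendsto_id.atTop_div_const two_pos)
    simpa using ((h₁.const_mul (Real.exp 1)).add (h₂.mul_const (2 ^ B))).const_mul M
  obtain ⟨L, hLtail, hL⟩ :=
    ((htails.eventually_lt_const (half_pos hε)).and (eventually_ge_atTop 2)).exists
  filter_upwards [Ioo_mem_nhdsLT (zero_lt_one (α := ℝ)), eventually_mul_one_sub_lt L one_pos,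
    hF (2 * L) (ε / 2) (half_pos hε), hM] with s hs hLs hFs hMs
  rw [Real.norm_of_nonneg (abelMean_nonneg (fun k => (hp.pos (fun i => hθ.trans_le (hv i)) k).le)
    (fun k => norm_nonneg _) hs.1.le)]
  suffices hwindow : ∀ k : ℕ, 1 ≤ L * (k * (1 - s)) → k * (1 - s) ≤ L →
      ‖F (expRadius 1 k) - F s‖ ≤ ε / 2 by
    linarith [hp.abelMean_le_of_window hθ hv hB hs.1.le hs.2 hL hLs.le
      (fun k => norm_nonneg _) hMs (half_pos hε).le hwindow]
  intro k hlow hhigh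
  have hk : 0 < k := k.pos_of_ne_zero fun hk => by norm_num [hk] at hlow
  have hk1 : 1 ≤ (k : ℝ) := by exact_mod_cast hk
  have hinv : 1 / (k : ℝ) ≤ L * (1 - s) := by
    rw [div_le_iff₀ (by positivity)]
    linarith
  have hinv' : 1 - s ≤ L * (1 / k) := by
    rw [mul_one_div, le_div_iff₀ (by positivity)]
    linarith
  have hupper : expRadius 1 k ≤ 1 - 1 / k / 2 :=
    exp_neg_le_one_sub_half (by positivity) (by rwa [div_le_one (by positivity)])
  have hlower : 1 - 1 / k ≤ expRadius 1 k := Real.one_sub_le_exp_neg _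
  refine hFs _ (expRadius_lt_one one_pos hk) ?_ ?_
  · nlinarith [mul_nonneg (by linarith : (0 : ℝ) ≤ L) (sub_nonneg.2 hs.2.le)]
  · nlinarith

end IsExpCoeff

end Concentration

section SmoothCutoff

/-- The kernel `ρ ^ k * (ρ ^ k - ρ ^ n)` with `ρ = expRadius c n`, a truncation to `k < n` that is
smooth enough for its means to be read off from Abel means at `ρ` and `ρ ^ 2`. -/
noncomputable def smoothCutoff (c : ℝ) (n k : ℕ) : ℝ :=
  expRadius c n ^ k * (expRadius c n ^ k - Real.exp (-c))

theorem abs_smoothCutoff_le {c : ℝ} (hc : 0 ≤ c) (n k : ℕ) :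
    |smoothCutoff c n k| ≤ expRadius c n ^ k := by
  have h₁ := expRadius_pow_le_one hc n k
  have h₂ := Real.exp_le_one_iff.2 (neg_nonpos.2 hc)
  have h₃ : 0 ≤ expRadius c n ^ k := pow_nonneg (expRadius_pos c n).le k
  rw [smoothCutoff, abs_mul, abs_of_nonneg h₃]
  exact mul_le_of_le_one_right h₃ (abs_le.2 ⟨by linarith, by linarith [Real.exp_pos (-c)]⟩)

theorem smoothCutoff_nonpos {c : ℝ} (hc : 0 ≤ c) {n k : ℕ} (hn : 0 < n) (hk : n ≤ k) :
    smoothCutoff c n k ≤ 0 := by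
  refine mul_nonpos_of_nonneg_of_nonpos (pow_nonneg (expRadius_pos c n).le k)
    (sub_nonpos.2 ?_)
  rw [← expRadius_pow_self c hn]
  exact pow_le_pow_of_le_one (expRadius_pos c n).le (expRadius_le_one hc n) hk

theorem smoothCutoff_le_ite {c : ℝ} (hc : 0 ≤ c) {n : ℕ} (hn : 0 < n) (k : ℕ) :
    smoothCutoff c n k ≤ if k < n then 1 else 0 := by
  split_ifs with hk
  · exact (le_abs_self _).trans ((abs_smoothCutoff_le hc n k).trans (expRadius_pow_le_one hc n k))
  · exact smoothCutoff_nonpos hc hn (not_lt.1 hk)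

variable {E : Type*} [NormedAddCommGroup E] [NormedSpace ℝ E] [CompleteSpace E]
  {v p : ℕ → ℝ} {x : ℕ → E} {θ B M s c : ℝ}

namespace IsExpCoeff

theorem hasSum_smoothCutoff_smul (hp : IsExpCoeff v p) (hv : ∀ i, 0 ≤ v i) (hB : ∀ i, v i ≤ B)
    (hx : ∀ k, ‖x k‖ ≤ M) (hc : 0 < c) {n : ℕ} (hn : 0 < n) :
    HasSum (fun k => (p k * smoothCutoff c n k) • x k)
      (genSeries p (expRadius c n ^ 2) • abelMean p x (expRadius c n ^ 2)
        - Real.exp (-c) • genSeries p (expRadius c n) • abelMean p x (expRadius c n)) := by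
  set ρ := expRadius c n
  have hρ0 : 0 ≤ ρ := (expRadius_pos c n).le
  have hρ1 : ρ < 1 := expRadius_lt_one hc hn
  have hsum := hp.summableOnUnitBall_of_nonneg hv hB
  have hρ2 : ρ ^ 2 < 1 := pow_lt_one₀ hρ0 hρ1 two_ne_zero
  refine ((hsum.hasSum_smul (hp.genSeries_pos hv hB (sq_nonneg ρ) hρ2).ne' hx (sq_nonneg ρ) hρ2).sub
    ((hsum.hasSum_smul (hp.genSeries_pos hv hB hρ0 hρ1).ne' hx hρ0 hρ1).const_smul
      (Real.exp (-c)))).congr_fun fun k => ?_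
  rw [smul_smul, ← sub_smul, smoothCutoff]
  congr 1
  ring

theorem sum_range_le_exp_mul_genSeries_mul_abelMean (hp : IsExpCoeff v p) (hv : ∀ i, 0 < v i)
    (hB : ∀ i, v i ≤ B) (hc : 0 < c) {n : ℕ} (hn : 0 < n) {x : ℕ → ℝ} (hx : ∀ k, 0 ≤ x k)
    (hM : ∀ k, x k ≤ M) : ∑ k ∈ Finset.range n, p k * x k
      ≤ Real.exp c * (genSeries p (expRadius c n) * abelMean p x (expRadius c n)) := by
  have hρ1 : expRadius c n < 1 := expRadius_lt_one hc hn
  have hpos := fun k => (hp.pos hv k).le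
  have hhas := ((hp.summableOnUnitBall_of_nonneg (fun i => (hv i).le) hB).hasSum_smul
    (hp.genSeries_pos (fun i => (hv i).le) hB (expRadius_pos c n).le hρ1).ne' (x := x) (M := M)
    (fun k => by rw [Real.norm_of_nonneg (hx k)]; exact hM k) (expRadius_pos c n).le hρ1).mul_left
      (Real.exp c)
  simp only [smul_eq_mul] at hhas
  refine (Finset.sum_le_sum fun k hk => ?_).trans (sum_le_hasSum (Finset.range n)
    (fun k _ => mul_nonneg (Real.exp_pos c).le (mul_nonneg (mul_nonneg (hpos k)
      (pow_nonneg (expRadius_pos c n).le k)) (hx k))) hhas)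
  have hone : 1 ≤ Real.exp c * expRadius c n ^ k := by
    rw [← inv_le_iff_one_le_mul₀' (Real.exp_pos c), ← Real.exp_neg]
    exact exp_neg_le_expRadius_pow hc.le (Finset.mem_range.1 hk)
  calc p k * x k ≤ Real.exp c * expRadius c n ^ k * (p k * x k) :=
        le_mul_of_one_le_left (mul_nonneg (hpos k) (hx k)) hone
    _ = _ := by ring

theorem mul_self_le_mul_genSeries (hp : IsExpCoeff v p) (hv : ∀ i, 0 < v i) (hB : ∀ i, v i ≤ B)
    (hc : 0 < c) {n : ℕ} (hn : 0 < n) :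
    n * p n ≤ B * Real.exp c * genSeries p (expRadius c n) := by
  have hρ1 : expRadius c n < 1 := expRadius_lt_one hc hn
  have hG := hp.genSeries_pos (fun i => (hv i).le) hB (expRadius_pos c n).le hρ1
  have hsum := hp.sum_range_le_exp_mul_genSeries_mul_abelMean hv hB hc hn (fun _ => zero_le_one)
    fun _ => le_refl (1 : ℝ)
  simp only [abelMean_const hG.ne', mul_one] at hsum
  rw [mul_assoc]
  exact (hp.mul_le_mul_sum_range hv hB n).trans
    (mul_le_mul_of_nonneg_left hsum ((hv 0).le.trans (hB 0)))

theorem sub_mul_genSeries_le_sub (hp : IsExpCoeff v p) (hv : ∀ i, 0 ≤ v i) (hB : ∀ i, v i ≤ B)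
    (hs0 : 0 ≤ s) (hs1 : s < 1) (a : ℝ) :
    ((2 ^ B)⁻¹ - a) * genSeries p s ≤ genSeries p (s ^ 2) - a * genSeries p s := by
  have h := hp.genSeries_le_two_rpow_mul hv hB hs0 hs1
  rw [sub_mul]
  gcongr
  rwa [inv_mul_le_iff₀ (by positivity)]

theorem mul_genSeries_le_mul_self (hp : IsExpCoeff v p) (hθ : 0 < θ) (hv : ∀ i, θ ≤ v i)
    (hB : ∀ i, v i ≤ B) (hc : 0 < c) {n : ℕ} (hn : 0 < n) :
    θ * ((2 ^ B)⁻¹ - Real.exp (-c)) * genSeries p (expRadius c n) ≤ n * p n := by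
  have hv0 : ∀ i, 0 < v i := fun i => hθ.trans_le (hv i)
  have hv0' : ∀ i, 0 ≤ v i := fun i => (hv0 i).le
  set ρ := expRadius c n
  have hρ0 : 0 ≤ ρ := (expRadius_pos c n).le
  have hρ1 : ρ < 1 := expRadius_lt_one hc hn
  have hcut := hp.hasSum_smoothCutoff_smul hv0' hB
    (fun _ => (norm_one (α := ℝ)).le) hc hn
  rw [abelMean_const (hp.genSeries_pos hv0' hB (sq_nonneg ρ) (by nlinarith)).ne',
    abelMean_const (hp.genSeries_pos hv0' hB hρ0 hρ1).ne'] at hcut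
  have hfin : HasSum (fun k => if k ∈ Finset.range n then p k else 0)
      (∑ k ∈ Finset.range n, p k) := by
    rw [← Finset.sum_congr rfl fun k hk => if_pos hk]
    exact hasSum_sum_of_ne_finset_zero fun k hk => if_neg hk
  have hle : genSeries p (ρ ^ 2) - Real.exp (-c) * genSeries p ρ ≤ ∑ k ∈ Finset.range n, p k := by
    refine hasSum_le (fun k => ?_) (by simpa using hcut) hfin
    have := mul_le_mul_of_nonneg_left (smoothCutoff_le_ite hc.le hn k) (hp.pos hv0 k).le
    simpa using this
  rw [mul_assoc]
  exact (mul_le_mul_of_nonneg_left ((hp.sub_mul_genSeries_le_sub hv0' hB hρ0 hρ1 _).trans hle)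
    hθ.le).trans (hp.mul_sum_range_le_mul hθ hv n)

end IsExpCoeff

end SmoothCutoff

section Contraction

variable {E : Type*} [NormedAddCommGroup E] [NormedSpace ℝ E]

/-- The average of `x` over `range n` with weights proportional to `v (n - 1 - k) * p k`. If
`IsExpCoeff v p`, the total weight is `n * p n`; at `n = 0` the value is `0`. -/
noncomputable def recursionMean (v p : ℕ → ℝ) (x : ℕ → E) (n : ℕ) : E :=
  (n * p n)⁻¹ • ∑ k ∈ Finset.range n, (v (n - 1 - k) * p k) • x k

/-- What is left of the kernel `v (n - 1 - k)` on `k < n` after removing a multiple of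
`smoothCutoff`; that multiple is small enough for the remainder to be nonnegative. -/
noncomputable def remainderKernel (v : ℕ → ℝ) (θ c : ℝ) (n k : ℕ) : ℝ :=
  (if k < n then v (n - 1 - k) else 0) - θ * smoothCutoff c n k

variable {v p : ℕ → ℝ} {x : ℕ → E} {θ B M c : ℝ} {n : ℕ}

theorem remainderKernel_nonneg (hθ : 0 ≤ θ) (hv : ∀ i, θ ≤ v i) (hc : 0 ≤ c) (hn : 0 < n) (k : ℕ) :
    0 ≤ remainderKernel v θ c n k := by
  have h := mul_le_mul_of_nonneg_left (smoothCutoff_le_ite hc hn k) hθ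
  rw [remainderKernel, sub_nonneg]
  split_ifs with hk
  · exact h.trans (by simpa [hk] using hv _)
  · simpa [hk] using h

theorem remainderKernel_le (hθ : 0 ≤ θ) (hB : ∀ i, v i ≤ B) (hB0 : 0 ≤ B) (hc : 0 ≤ c) (k : ℕ) :
    remainderKernel v θ c n k ≤ (B * Real.exp c + θ) * expRadius c n ^ k := by
  have hcut := mul_le_mul_of_nonneg_left
    ((neg_le_abs _).trans (abs_smoothCutoff_le hc n k)) hθ
  have hmain : (if k < n then v (n - 1 - k) else 0) ≤ B * Real.exp c * expRadius c n ^ k := by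
    split_ifs with hk
    · have hone : 1 ≤ Real.exp c * expRadius c n ^ k := by
        rw [← inv_le_iff_one_le_mul₀' (Real.exp_pos c), ← Real.exp_neg]
        exact exp_neg_le_expRadius_pow hc hk
      rw [mul_assoc]
      exact (hB _).trans (le_mul_of_one_le_right hB0 hone)
    · have := expRadius_pos c n
      positivity
  rw [remainderKernel]
  linarith

theorem norm_smul_remainderKernel_le (hθ : 0 ≤ θ) (hv : ∀ i, θ ≤ v i) (hB : ∀ i, v i ≤ B)
    (hc : 0 ≤ c) (hn : 0 < n) {a : ℝ} (ha : 0 ≤ a) (b : ℝ) (y : E) (k : ℕ) :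
    ‖(a * remainderKernel v θ c n k) • y‖ ≤ a * remainderKernel v θ c n k * b
      + (B * Real.exp c + θ) * (a * expRadius c n ^ k * max (‖y‖ - b) 0) := by
  have hκ := remainderKernel_nonneg hθ hv hc hn k
  have hκ' := remainderKernel_le (n := n) hθ hB ((hθ.trans (hv 0)).trans (hB 0)) hc k
  rw [norm_smul, Real.norm_of_nonneg (mul_nonneg ha hκ)]
  calc a * remainderKernel v θ c n k * ‖y‖
      ≤ a * remainderKernel v θ c n k * (b + max (‖y‖ - b) 0) := by
        gcongr
        linarith [le_max_left (‖y‖ - b) 0]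
    _ = a * remainderKernel v θ c n k * b
        + a * remainderKernel v θ c n k * max (‖y‖ - b) 0 := mul_add ..
    _ ≤ a * remainderKernel v θ c n k * b
        + a * ((B * Real.exp c + θ) * expRadius c n ^ k) * max (‖y‖ - b) 0 := by gcongr
    _ = _ := by ring

namespace IsExpCoeff

theorem smul_recursionMean (hp : IsExpCoeff v p) (hv : ∀ i, 0 < v i) (hn : 0 < n) (x : ℕ → E) :
    (n * p n) • recursionMean v p x n
      = ∑ k ∈ Finset.range n, (v (n - 1 - k) * p k) • x k :=
  smul_inv_smul₀ (mul_pos (Nat.cast_pos.2 hn) (hp.pos hv n)).ne' _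

theorem recursionMean_const (hp : IsExpCoeff v p) (hv : ∀ i, 0 < v i) (hn : 0 < n) (b : E) :
    recursionMean v p (fun _ => b) n = b := by
  rw [recursionMean, ← Finset.sum_smul, ← hp.2]
  exact inv_smul_smul₀ (mul_pos (Nat.cast_pos.2 hn) (hp.pos hv n)).ne' b

theorem hasSum_remainderKernel_smul [CompleteSpace E] (hp : IsExpCoeff v p)
    (hv : ∀ i, 0 < v i) (hB : ∀ i, v i ≤ B) (hx : ∀ k, ‖x k‖ ≤ M) (hc : 0 < c) (hn : 0 < n) :
    HasSum (fun k => (p k * remainderKernel v θ c n k) • x k)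
      ((n * p n) • recursionMean v p x n
        - θ • (genSeries p (expRadius c n ^ 2) • abelMean p x (expRadius c n ^ 2)
          - Real.exp (-c) • genSeries p (expRadius c n) • abelMean p x (expRadius c n))) := by
  have hfin : HasSum
      (fun k => if k ∈ Finset.range n then (v (n - 1 - k) * p k) • x k else 0)
      ((n * p n) • recursionMean v p x n) := by
    rw [hp.smul_recursionMean hv hn, ← Finset.sum_congr rfl fun k hk => if_pos hk]
    exact hasSum_sum_of_ne_finset_zero fun k hk => if_neg hk
  refine (hfin.sub ((hp.hasSum_smoothCutoff_smul (fun i => (hv i).le) hB hx hc hn).const_smul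
    θ)).congr_fun fun k => ?_
  simp only [Finset.mem_range, remainderKernel]
  split_ifs <;> module

theorem norm_tsum_remainderKernel_smul_le (hp : IsExpCoeff v p) (hθ : 0 < θ) (hv : ∀ i, θ ≤ v i)
    (hB : ∀ i, v i ≤ B) (hx : ∀ k, ‖x k‖ ≤ M) (hc : 0 < c) (hn : 0 < n) {b : ℝ} (hb : 0 ≤ b) :
    ‖∑' k, (p k * remainderKernel v θ c n k) • x k‖
      ≤ (n * p n - θ * ((2 ^ B)⁻¹ - Real.exp (-c)) * genSeries p (expRadius c n)) * b
        + (B * Real.exp c + θ) * (genSeries p (expRadius c n)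
          * abelMean p (fun k => max (‖x k‖ - b) 0) (expRadius c n)) := by
  have hv0 : ∀ i, 0 < v i := fun i => hθ.trans_le (hv i)
  have hv0' : ∀ i, 0 ≤ v i := fun i => (hv0 i).le
  set ρ := expRadius c n
  have hρ0 : 0 ≤ ρ := (expRadius_pos c n).le
  have hρ1 : ρ < 1 := expRadius_lt_one hc hn
  have hG := hp.genSeries_pos hv0' hB hρ0 hρ1
  have hexcess : ∀ k, ‖max (‖x k‖ - b) 0‖ ≤ M := fun k => by
    rw [Real.norm_of_nonneg (le_max_right _ _)]
    exact max_le (by linarith [hx k]) ((norm_nonneg _).trans (hx k))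
  have hmass := hp.hasSum_remainderKernel_smul (θ := θ) hv0 hB (fun _ => le_refl ‖b‖) hc hn
  rw [hp.recursionMean_const hv0 hn,
    abelMean_const (hp.genSeries_pos hv0' hB (sq_nonneg ρ) (by nlinarith)).ne',
    abelMean_const hG.ne'] at hmass
  have hdev := ((hp.summableOnUnitBall_of_nonneg hv0' hB).hasSum_smul hG.ne'
    hexcess hρ0 hρ1).mul_left (B * Real.exp c + θ)
  refine (tsum_of_norm_bounded (hmass.add hdev) fun k =>
    norm_smul_remainderKernel_le hθ.le hv hB hc.le hn (hp.pos hv0 k).le b (x k) k).trans ?_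
  have hcut := mul_le_mul_of_nonneg_left
    (hp.sub_mul_genSeries_le_sub hv0' hB hρ0 hρ1 (Real.exp (-c))) (mul_nonneg hθ.le hb)
  simp only [smul_eq_mul]
  linarith

theorem mul_norm_recursionMean_le [CompleteSpace E] (hp : IsExpCoeff v p) (hθ : 0 < θ)
    (hv : ∀ i, θ ≤ v i) (hB : ∀ i, v i ≤ B) (hx : ∀ k, ‖x k‖ ≤ M) (hc : 0 < c) (hn : 0 < n)
    {b : ℝ} (hb : 0 ≤ b) : n * p n * ‖recursionMean v p x n‖
      ≤ (n * p n - θ * ((2 ^ B)⁻¹ - Real.exp (-c)) * genSeries p (expRadius c n)) * b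
        + genSeries p (expRadius c n) * ((B * Real.exp c + θ)
            * abelMean p (fun k => max (‖x k‖ - b) 0) (expRadius c n)
          + θ * (‖abelMean p x (expRadius c n ^ 2)‖ + ‖abelMean p x (expRadius c n)‖)) := by
  have hv0 : ∀ i, 0 < v i := fun i => hθ.trans_le (hv i)
  have hv0' : ∀ i, 0 ≤ v i := fun i => (hv0 i).le
  have hrem := hp.norm_tsum_remainderKernel_smul_le hθ hv hB hx hc hn hb
  rw [(hp.hasSum_remainderKernel_smul hv0 hB hx hc hn).tsum_eq] at hrem
  set ρ := expRadius c n
  have hρ0 : 0 ≤ ρ := (expRadius_pos c n).le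
  have hρ1 : ρ < 1 := expRadius_lt_one hc hn
  have hG := hp.genSeries_pos hv0' hB hρ0 hρ1
  have hG2 := hp.genSeries_pos hv0' hB (sq_nonneg ρ) (by nlinarith)
  have hmono : genSeries p (ρ ^ 2) ≤ genSeries p ρ := by
    simpa using hp.genSeries_le_rpow_mul_of_forall_ge le_rfl hv0' hB (sq_nonneg ρ)
      (by nlinarith) hρ1
  have hcut : ‖θ • (genSeries p (ρ ^ 2) • abelMean p x (ρ ^ 2)
      - Real.exp (-c) • genSeries p ρ • abelMean p x ρ)‖
        ≤ θ * (genSeries p ρ * ‖abelMean p x (ρ ^ 2)‖ + genSeries p ρ * ‖abelMean p x ρ‖) := by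
    rw [norm_smul, Real.norm_of_nonneg hθ.le]
    refine mul_le_mul_of_nonneg_left ((norm_sub_le _ _).trans (add_le_add ?_ ?_)) hθ.le
    · rw [norm_smul, Real.norm_of_nonneg hG2.le]
      gcongr
    · rw [norm_smul, norm_smul, Real.norm_of_nonneg (Real.exp_pos _).le,
        Real.norm_of_nonneg hG.le]
      exact mul_le_of_le_one_left (by positivity) (Real.exp_le_one_iff.2 (by linarith))
  have hnorm : ‖(n * p n) • recursionMean v p x n‖ = n * p n * ‖recursionMean v p x n‖ := by
    rw [norm_smul, Real.norm_of_nonneg (mul_nonneg n.cast_nonneg (hp.pos hv0 n).le)]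
  rw [← hnorm]
  linarith [norm_le_norm_add_norm_sub' ((n * p n) • recursionMean v p x n)
    (θ • (genSeries p (ρ ^ 2) • abelMean p x (ρ ^ 2)
      - Real.exp (-c) • genSeries p ρ • abelMean p x ρ))]

end IsExpCoeff

end Contraction

section Tauberian

theorem tendsto_zero_of_forall_eventually_le_mul {ι : Type*} {l : Filter ι} {x : ι → ℝ} {M q : ℝ}
    (hx : ∀ i, 0 ≤ x i) (hM : ∀ᶠ i in l, x i ≤ M) (hq : q < 1)
    (hcontract : ∀ b > 0, (∀ᶠ i in l, x i ≤ b) → ∀ᶠ i in l, x i ≤ q * b) :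
    Tendsto x l (𝓝 0) := by
  set Q := max q (1 / 2)
  have hQ0 : 0 < Q := lt_max_of_lt_right one_half_pos
  have hQ1 : Q < 1 := max_lt hq one_half_lt_one
  have hpow : ∀ j : ℕ, ∀ᶠ i in l, x i ≤ Q ^ j * max M 1 := fun j => by
    induction j with
    | zero => simpa using hM.mono fun i hi => Or.inl hi
    | succ j ih =>
      filter_upwards [hcontract _ (by positivity) ih] with i hi
      refine hi.trans ?_
      rw [pow_succ', mul_assoc]
      gcongr
      exact le_max_left _ _
  have hlim : Tendsto (fun j : ℕ => Q ^ j * max M 1) atTop (𝓝 0) := by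
    simpa using (tendsto_pow_atTop_nhds_zero_of_lt_one hQ0.le hQ1).mul_const (max M 1)
  refine NormedAddGroup.tendsto_nhds_zero.2 fun ε hε => ?_
  obtain ⟨j, hj⟩ := (hlim.eventually_lt_const hε).exists
  filter_upwards [hpow j] with i hi
  rw [Real.norm_of_nonneg (hx i)]
  exact hi.trans_lt hj

variable {E : Type*} [NormedAddCommGroup E] [NormedSpace ℝ E] [CompleteSpace E]
  {v p : ℕ → ℝ} {x : ℕ → E} {θ B M c : ℝ}

theorem exp_neg_add_one_lt_inv_two_rpow (hB : 0 ≤ B) : Real.exp (-(B + 1)) < (2 ^ B)⁻¹ := by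
  rw [Real.exp_neg]
  refine inv_strictAnti₀ (by positivity) ?_
  calc (2 : ℝ) ^ B ≤ Real.exp 1 ^ B := by
        gcongr
        linarith [Real.add_one_le_exp 1]
    _ = Real.exp B := by rw [← Real.exp_mul, one_mul]
    _ < Real.exp (B + 1) := Real.exp_lt_exp.2 (lt_add_one B)

namespace IsExpCoeff

theorem norm_recursionMean_le (hp : IsExpCoeff v p) (hθ : 0 < θ) (hv : ∀ i, θ ≤ v i)
    (hB : ∀ i, v i ≤ B) (hx : ∀ k, ‖x k‖ ≤ M) (hc : 0 < c) {δ : ℝ} (hδ : 0 < δ)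
    (hcδ : Real.exp (-c) + δ ≤ (2 ^ B)⁻¹) {n : ℕ} (hn : 0 < n) {b : ℝ} (hb : 0 ≤ b) :
    ‖recursionMean v p x n‖ ≤ (1 - θ * δ / (B * Real.exp c)) * b
      + (θ * δ)⁻¹ * ((B * Real.exp c + θ)
            * abelMean p (fun k => max (‖x k‖ - b) 0) (expRadius c n)
          + θ * (‖abelMean p x (expRadius c n ^ 2)‖ + ‖abelMean p x (expRadius c n)‖)) := by
  have hv0 : ∀ i, 0 < v i := fun i => hθ.trans_le (hv i)
  have hB0 : 0 < B := (hv0 0).trans_le (hB 0)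
  have hN : 0 < n * p n := mul_pos (Nat.cast_pos.2 hn) (hp.pos hv0 n)
  have hG := hp.genSeries_pos (fun i => (hv0 i).le) hB (expRadius_pos c n).le
    (expRadius_lt_one hc hn)
  have hδθ : θ * δ * genSeries p (expRadius c n)
      ≤ θ * ((2 ^ B)⁻¹ - Real.exp (-c)) * genSeries p (expRadius c n) := by
    gcongr
    linarith
  have hupper := hδθ.trans (hp.mul_genSeries_le_mul_self hθ hv hB hc hn)
  have hlower := hp.mul_self_le_mul_genSeries hv0 hB hc hn
  have herr : 0 ≤ (B * Real.exp c + θ)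
            * abelMean p (fun k => max (‖x k‖ - b) 0) (expRadius c n)
          + θ * (‖abelMean p x (expRadius c n ^ 2)‖ + ‖abelMean p x (expRadius c n)‖) := by
    have := abelMean_nonneg (fun k => (hp.pos hv0 k).le)
      (fun k => le_max_right (‖x k‖ - b) 0) (expRadius_pos c n).le
    positivity
  have hrec := hp.mul_norm_recursionMean_le hθ hv hB hx hc hn hb
  set e := (B * Real.exp c + θ)
            * abelMean p (fun k => max (‖x k‖ - b) 0) (expRadius c n)
          + θ * (‖abelMean p x (expRadius c n ^ 2)‖ + ‖abelMean p x (expRadius c n)‖)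
  refine le_of_mul_le_mul_left (hrec.trans ?_) hN
  have hmain : θ * δ / (B * Real.exp c) * (n * p n) ≤ θ * δ * genSeries p (expRadius c n) := by
    rw [div_mul_eq_mul_div, div_le_iff₀ (by positivity)]
    calc θ * δ * (n * p n) ≤ θ * δ * (B * Real.exp c * genSeries p (expRadius c n)) := by gcongr
      _ = _ := by ring
  have herror : genSeries p (expRadius c n) * e ≤ n * p n * ((θ * δ)⁻¹ * e) := by
    rw [← mul_assoc]
    gcongr
    rwa [le_mul_inv_iff₀ (by positivity), mul_comm]
  linarith [mul_le_mul_of_nonneg_right (hmain.trans hδθ) hb]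

theorem tendsto_zero_of_abelMean (hp : IsExpCoeff v p) (hθ : 0 < θ) (hv : ∀ i, θ ≤ v i)
    (hB : ∀ i, v i ≤ B) (hx : ∀ k, ‖x k‖ ≤ M) (habel : Tendsto (abelMean p x) (𝓝[<] 1) (𝓝 0))
    (hrec : Tendsto (fun n => x n - recursionMean v p x n) atTop (𝓝 0)) :
    Tendsto x atTop (𝓝 0) := by
  have hB0 : 0 < B := (hθ.trans_le (hv 0)).trans_le (hB 0)
  set c := B + 1
  have hc : 0 < c := by positivity
  set δ := (2 ^ B)⁻¹ - Real.exp (-c)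
  have hδ : 0 < δ := sub_pos.2 (exp_neg_add_one_lt_inv_two_rpow hB0.le)
  set γ := θ * δ / (B * Real.exp c)
  have hγ : 0 < γ := by positivity
  refine tendsto_zero_iff_norm_tendsto_zero.2 (tendsto_zero_of_forall_eventually_le_mul
    (q := 1 - γ / 2) (fun n => norm_nonneg _) (.of_forall hx) (by linarith) fun b hb hxb => ?_)
  have hexcess : Tendsto (fun k => max (‖x k‖ - b) 0) atTop (𝓝 0) :=
    tendsto_const_nhds.congr' (hxb.mono fun k hk => (max_eq_right (by linarith)).symm)
  have hρ := tendsto_expRadius hc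
  have hρ2 : Tendsto (fun n : ℕ => expRadius c n ^ 2) atTop (𝓝[<] 1) := by
    simpa [expRadius, ← Real.exp_nat_mul, mul_div_assoc] using
      tendsto_expRadius (mul_pos two_pos hc)
  have herr : Tendsto (fun n => ‖x n - recursionMean v p x n‖ + (θ * δ)⁻¹ *
      ((B * Real.exp c + θ) * abelMean p (fun k => max (‖x k‖ - b) 0) (expRadius c n)
        + θ * (‖abelMean p x (expRadius c n ^ 2)‖ + ‖abelMean p x (expRadius c n)‖)))
      atTop (𝓝 0) := by
    simpa using hrec.norm.add (((((hp.tendsto_abelMean_zero hθ hv hB hexcess).comp hρ).const_mul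
      (B * Real.exp c + θ)).add (((habel.comp hρ2).norm.add (habel.comp hρ).norm).const_mul
        θ)).const_mul (θ * δ)⁻¹)
  filter_upwards [herr.eventually_le_const (mul_pos (half_pos hγ) hb), eventually_gt_atTop 0]
    with n hn hn0
  have hmean := hp.norm_recursionMean_le hθ hv hB hx hc hδ (by linarith) hn0 hb.le
  linarith [norm_le_norm_sub_add (x n) (recursionMean v p x n)]

end IsExpCoeff

end Tauberian

section RecursionError

variable {E : Type*} [NormedAddCommGroup E] [NormedSpace ℝ E]
  {v p : ℕ → ℝ} {θ B M : ℝ}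

theorem recursionMean_sub (x y : ℕ → E) (n : ℕ) :
    recursionMean v p (fun k => x k - y k) n = recursionMean v p x n - recursionMean v p y n := by
  simp only [recursionMean, smul_sub, Finset.sum_sub_distrib]

namespace IsExpCoeff

theorem norm_recursionMean_le_mul_sum (hp : IsExpCoeff v p) (hv : ∀ i, 0 < v i)
    (hB : ∀ i, v i ≤ B) (x : ℕ → E) (n : ℕ) :
    ‖recursionMean v p x n‖ ≤ (n * p n)⁻¹ * (B * ∑ k ∈ Finset.range n, p k * ‖x k‖) := by
  have hN : 0 ≤ n * p n := mul_nonneg n.cast_nonneg (hp.pos hv n).le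
  rw [recursionMean, norm_smul, Real.norm_of_nonneg (inv_nonneg.2 hN), Finset.mul_sum]
  gcongr
  refine norm_sum_le_of_le _ fun k _ => ?_
  have hpk := (hp.pos hv k).le
  rw [norm_smul, Real.norm_of_nonneg (mul_nonneg (hv _).le hpk), mul_assoc]
  gcongr
  exact hB _

theorem genSeries_expRadius_one_le (hp : IsExpCoeff v p) (hv : ∀ i, 0 ≤ v i) (hB : ∀ i, v i ≤ B)
    {c : ℝ} (hc : 1 ≤ c) {n : ℕ} (hn : 0 < n) :
    genSeries p (expRadius 1 n) ≤ c ^ B * genSeries p (expRadius c n) := by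
  have hc0 : 0 < c := one_pos.trans_le hc
  have ht1 := expRadius_lt_one one_pos hn
  have hρ1 := expRadius_lt_one hc0 hn
  have hpow : expRadius c n = expRadius 1 n ^ c := by
    rw [expRadius, expRadius, ← Real.exp_mul]
    congr 1
    ring
  have hle : expRadius c n ≤ expRadius 1 n :=
    Real.exp_le_exp.2 (neg_le_neg (by gcongr))
  have hbernoulli : 1 - expRadius c n ≤ c * (1 - expRadius 1 n) := by
    have := one_add_mul_self_le_rpow_one_add
      (by linarith [expRadius_pos 1 n] : -1 ≤ expRadius 1 n - 1) hc
    rw [add_sub_cancel, ← hpow] at this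
    linarith
  refine (hp.genSeries_le_rpow_mul_of_forall_le hv hB (expRadius_pos c n).le hle ht1).trans ?_
  have hG := (hp.genSeries_pos hv hB (expRadius_pos c n).le hρ1).le
  have hB0 := (hv 0).trans (hB 0)
  have := div_nonneg (sub_nonneg.2 hρ1.le) (sub_nonneg.2 ht1.le)
  gcongr
  exact (div_le_iff₀ (sub_pos.2 ht1)).2 hbernoulli

theorem exists_genSeries_expRadius_one_le (hp : IsExpCoeff v p) (hθ : 0 < θ) (hv : ∀ i, θ ≤ v i)
    (hB : ∀ i, v i ≤ B) : ∃ C, ∀ n : ℕ, 0 < n → genSeries p (expRadius 1 n) ≤ C * (n * p n) := by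
  have hB0 : 0 ≤ B := hθ.le.trans ((hv 0).trans (hB 0))
  have hκ : 0 < θ * ((2 ^ B)⁻¹ - Real.exp (-(B + 1))) :=
    mul_pos hθ (sub_pos.2 (exp_neg_add_one_lt_inv_two_rpow hB0))
  refine ⟨(B + 1) ^ B * (θ * ((2 ^ B)⁻¹ - Real.exp (-(B + 1))))⁻¹, fun n hn => ?_⟩
  refine (hp.genSeries_expRadius_one_le (fun i => hθ.le.trans (hv i)) hB
    (le_add_of_nonneg_left hB0) hn).trans ?_
  rw [mul_assoc]
  gcongr
  rw [le_inv_mul_iff₀ hκ]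
  exact hp.mul_genSeries_le_mul_self hθ hv hB (by positivity) hn

theorem tendsto_sub_recursionMean_of_slowlyVarying {F : ℝ → E} (hp : IsExpCoeff v p) (hθ : 0 < θ)
    (hv : ∀ i, θ ≤ v i) (hB : ∀ i, v i ≤ B) (hF : SlowlyVaryingAtOne F)
    (hM : ∀ᶠ s in 𝓝[<] (1 : ℝ), ∀ k : ℕ, ‖F (expRadius 1 k) - F s‖ ≤ M) :
    Tendsto (fun n => F (expRadius 1 n) - recursionMean v p (fun k => F (expRadius 1 k)) n)
      atTop (𝓝 0) := by
  have hv0 : ∀ i, 0 < v i := fun i => hθ.trans_le (hv i)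
  have hB0 : 0 ≤ B := (hv0 0).le.trans (hB 0)
  obtain ⟨C, hC⟩ := hp.exists_genSeries_expRadius_one_le hθ hv hB
  have ht := tendsto_expRadius one_pos
  have hdev := ((hp.tendsto_abelMean_norm_sub hθ hv hB hF hM).comp ht).const_mul
    (B * (Real.exp 1 * C))
  rw [mul_zero] at hdev
  refine squeeze_zero_norm' ?_ hdev
  filter_upwards [ht.eventually hM, eventually_gt_atTop 0] with n hMn hn
  set t := expRadius 1 n
  have hN : 0 < n * p n := mul_pos (Nat.cast_pos.2 hn) (hp.pos hv0 n)
  have hmean := hp.norm_recursionMean_le_mul_sum hv0 hB (fun k => F (expRadius 1 k) - F t) n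
  rw [recursionMean_sub, hp.recursionMean_const hv0 hn, norm_sub_rev] at hmean
  have hsum := hp.sum_range_le_exp_mul_genSeries_mul_abelMean hv0 hB one_pos hn
    (fun k => norm_nonneg (F (expRadius 1 k) - F t)) hMn
  have hmean0 := abelMean_nonneg (fun k => (hp.pos hv0 k).le)
    (fun k => norm_nonneg (F (expRadius 1 k) - F t)) (expRadius_pos 1 n).le
  rw [inv_mul_eq_div, le_div_iff₀ hN] at hmean
  refine le_of_mul_le_mul_right (hmean.trans ?_) hN
  calc B * ∑ k ∈ Finset.range n, p k * ‖F (expRadius 1 k) - F t‖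
      ≤ B * (Real.exp 1 * (C * (n * p n) * abelMean p (fun k => ‖F (expRadius 1 k) - F t‖) t)) := by
        gcongr
        refine hsum.trans ?_
        gcongr
        exact hC n hn
    _ = _ := by
        simp only [Function.comp_apply]
        ring

theorem cast_mul_le_of_le (hp : IsExpCoeff v p) (hθ : 0 < θ) (hv : ∀ i, θ ≤ v i)
    (hB : ∀ i, v i ≤ B) {k n : ℕ} (hkn : k ≤ n) : k * p k ≤ B / θ * (n * p n) := by
  have hv0 : ∀ i, 0 < v i := fun i => hθ.trans_le (hv i)
  have hB0 := (hv0 0).le.trans (hB 0)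
  have hsum : ∑ i ∈ Finset.range k, p i ≤ ∑ i ∈ Finset.range n, p i :=
    Finset.sum_le_sum_of_subset_of_nonneg (Finset.range_mono hkn) fun i _ _ => (hp.pos hv0 i).le
  calc k * p k ≤ B * ∑ i ∈ Finset.range k, p i := hp.mul_le_mul_sum_range hv0 hB k
    _ ≤ B * (θ⁻¹ * (n * p n)) := by
        refine mul_le_mul_of_nonneg_left (hsum.trans ?_) hB0
        rw [le_inv_mul_iff₀ hθ]
        exact hp.mul_sum_range_le_mul hθ hv n
    _ = _ := by ring

theorem tendsto_shift_div (hp : IsExpCoeff v p) (hθ : 0 < θ) (hv : ∀ i, θ ≤ v i)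
    (hB : ∀ i, v i ≤ B) (j : ℕ) :
    Tendsto (fun n : ℕ => p (n - 1 - j) / (n * p n)) atTop (𝓝 0) := by
  have hv0 : ∀ i, 0 < v i := fun i => hθ.trans_le (hv i)
  have hlim : Tendsto (fun n : ℕ => B / θ / ((n - (1 + j) : ℕ) : ℝ)) atTop (𝓝 0) :=
    (tendsto_const_div_atTop_nhds_zero_nat (B / θ)).comp (tendsto_sub_atTop_nat (1 + j))
  refine squeeze_zero' (.of_forall fun n => div_nonneg (hp.pos hv0 _).le
    (mul_nonneg n.cast_nonneg (hp.pos hv0 n).le)) ?_ hlim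
  filter_upwards [eventually_gt_atTop (1 + j)] with n hn
  have hN : 0 < n * p n := mul_pos (Nat.cast_pos.2 (by omega)) (hp.pos hv0 n)
  rw [Nat.sub_sub, div_le_div_iff₀ hN (Nat.cast_pos.2 (Nat.sub_pos_of_lt hn)), mul_comm (p _)]
  exact hp.cast_mul_le_of_le hθ hv hB (Nat.sub_le _ _)

theorem tendsto_reflected_mean_zero (hp : IsExpCoeff v p) (hθ : 0 < θ) (hv : ∀ i, θ ≤ v i)
    (hB : ∀ i, v i ≤ B) {y : ℕ → ℝ} (hy : Tendsto y atTop (𝓝 0)) :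
    Tendsto (fun n => recursionMean v p (fun k => y (n - 1 - k)) n) atTop (𝓝 0) := by
  have hv0 : ∀ i, 0 < v i := fun i => hθ.trans_le (hv i)
  set w : ℕ → ℕ → ℝ := fun n j => if j < n then v j * (p (n - 1 - j) / (n * p n)) else 0
  have hw : ∀ {n j}, j < n → w n j = v j * (p (n - 1 - j) / (n * p n)) := fun h => if_pos h
  have hfin : ∀ (n : ℕ) (z : ℕ → ℝ), HasSum (fun j => w n j • z j)
      (recursionMean v p (fun k => z (n - 1 - k)) n) := fun n z => by
    have hval : recursionMean v p (fun k => z (n - 1 - k)) n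
        = ∑ j ∈ Finset.range n, w n j • z j := by
      rw [recursionMean, smul_eq_mul, ← Finset.sum_range_reflect, Finset.mul_sum]
      refine Finset.sum_congr rfl fun j hj => ?_
      have hjn := Finset.mem_range.1 hj
      rw [hw hjn, show n - 1 - (n - 1 - j) = j by omega, smul_eq_mul, smul_eq_mul]
      ring
    rw [hval]
    exact hasSum_sum_of_ne_finset_zero fun j hj => by
      rw [show w n j = 0 from if_neg (mt Finset.mem_range.2 hj), zero_smul]
  have hone : ∀ n, HasSum (w n) (recursionMean v p (fun _ => (1 : ℝ)) n) := fun n => by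
    simpa using hfin n fun _ => 1
  refine (tendsto_tsum_smul_zero (C := 1) (.of_forall fun n j => ?_)
    (.of_forall fun n => (hone n).summable) ?_ (fun j => ?_) hy).congr fun n => (hfin n y).tsum_eq
  · have := (hv0 j).le
    have := (hp.pos hv0 (n - 1 - j)).le
    have := (hp.pos hv0 n).le
    simp only [w]
    positivity
  · filter_upwards [eventually_gt_atTop 0] with n hn
    rw [(hone n).tsum_eq, hp.recursionMean_const hv0 hn]
  · have h := (hp.tendsto_shift_div hθ hv hB j).const_mul (v j)
    rw [mul_zero] at h
    refine h.congr' ?_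
    filter_upwards [eventually_gt_atTop j] with n hn
    rw [hw hn]

end IsExpCoeff

end RecursionError

section Twist

theorem norm_exp_logSeries_le_one {a : ℕ → ℂ} (ha : ∀ i, (a i).re ≤ 0) {s : ℝ} (hs : 0 ≤ s) :
    ‖Complex.exp (logSeries a s)‖ ≤ 1 := by
  rw [Complex.norm_exp, Real.exp_le_one_iff, logSeries]
  have hterm : ∀ i : ℕ, (a i * (s : ℂ) ^ (i + 1) / (i + 1)).re ≤ 0 := fun i => by
    have : a i * (s : ℂ) ^ (i + 1) / (i + 1) = ((s ^ (i + 1) / (i + 1) : ℝ) : ℂ) * a i := by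
      push_cast
      ring
    rw [this, Complex.re_ofReal_mul]
    exact mul_nonpos_of_nonneg_of_nonpos (by positivity) (ha i)
  by_cases hsum : Summable fun i : ℕ => a i * (s : ℂ) ^ (i + 1) / (i + 1)
  · rw [Complex.re_tsum hsum]
    exact tsum_nonpos hterm
  · rw [tsum_eq_zero_of_not_summable hsum, Complex.zero_re]

variable {v p : ℕ → ℝ} {φ m : ℕ → ℂ} {F : ℝ → ℂ} {θ B M : ℝ}

theorem norm_mul_sub_one_le (hv : ∀ i, 0 ≤ v i) (hB : ∀ i, v i ≤ B) (hφ : ∀ i, ‖φ i‖ ≤ 1) (i : ℕ) :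
    ‖(v i : ℂ) * (φ i - 1)‖ ≤ B * 2 := by
  rw [norm_mul, Complex.norm_real, Real.norm_of_nonneg (hv i)]
  refine mul_le_mul (hB i) ?_ (norm_nonneg _) ((hv i).trans (hB i))
  calc ‖φ i - 1‖ ≤ ‖φ i‖ + ‖(1 : ℂ)‖ := norm_sub_le _ _
    _ ≤ 2 := by
      rw [norm_one]
      linarith [hφ i]

namespace IsExpCoeff

theorem norm_le_of_norm_twist_le_one (hp : IsExpCoeff v p)
    (hm : IsExpCoeff (fun i => v i * φ i) m) (hv : ∀ i, 0 ≤ v i) (hφ : ∀ i, ‖φ i‖ ≤ 1) (n : ℕ) :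
    ‖m n‖ ≤ p n :=
  hm.norm_le hp (fun i => by
    rw [norm_mul, Complex.norm_real, Real.norm_of_nonneg (hv i)]
    exact mul_le_of_le_one_right (hv i) (hφ i)) n

theorem norm_inv_smul_le_one (hp : IsExpCoeff v p) (hm : IsExpCoeff (fun i => v i * φ i) m)
    (hv : ∀ i, 0 < v i) (hφ : ∀ i, ‖φ i‖ ≤ 1) (n : ℕ) : ‖(p n)⁻¹ • m n‖ ≤ 1 := by
  have hpn := hp.pos hv n
  rw [norm_smul, Real.norm_of_nonneg (inv_nonneg.2 hpn.le), inv_mul_le_iff₀ hpn, mul_one]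
  exact hp.norm_le_of_norm_twist_le_one hm (fun i => (hv i).le) hφ n

theorem tendsto_twist_sub_recursionMean (hp : IsExpCoeff v p)
    (hm : IsExpCoeff (fun i => v i * φ i) m) (hθ : 0 < θ) (hv : ∀ i, θ ≤ v i) (hB : ∀ i, v i ≤ B)
    (hφ : ∀ i, ‖φ i‖ ≤ 1) (hlim : Tendsto φ atTop (𝓝 1)) :
    Tendsto (fun n => (p n)⁻¹ • m n - recursionMean v p (fun k => (p k)⁻¹ • m k) n)
      atTop (𝓝 0) := by
  have hv0 : ∀ i, 0 < v i := fun i => hθ.trans_le (hv i)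
  have hy : Tendsto (fun i => ‖φ i - 1‖) atTop (𝓝 0) :=
    tendsto_iff_norm_sub_tendsto_zero.1 hlim
  refine squeeze_zero_norm' ?_ (hp.tendsto_reflected_mean_zero hθ hv hB hy)
  filter_upwards [eventually_gt_atTop 0] with n hn
  have hN : 0 < n * p n := mul_pos (Nat.cast_pos.2 hn) (hp.pos hv0 n)
  have hdiff : (p n)⁻¹ • m n - recursionMean v p (fun k => (p k)⁻¹ • m k) n
      = (n * p n)⁻¹ • ∑ k ∈ Finset.range n, v (n - 1 - k) * (φ (n - 1 - k) - 1) * m k := by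
    have hratio : (p n)⁻¹ • m n = (n * p n)⁻¹ • (n * m n) := by
      have hn' : (n : ℂ) ≠ 0 := Nat.cast_ne_zero.2 hn.ne'
      have hpn : (p n : ℂ) ≠ 0 := Complex.ofReal_ne_zero.2 (hp.pos hv0 n).ne'
      simp only [Complex.real_smul, Complex.ofReal_inv, Complex.ofReal_mul, Complex.ofReal_natCast]
      field_simp
    rw [hratio, hm.2, recursionMean, ← smul_sub, ← Finset.sum_sub_distrib]
    congr 1
    refine Finset.sum_congr rfl fun k _ => ?_
    have hpk : (p k : ℂ) ≠ 0 := Complex.ofReal_ne_zero.2 (hp.pos hv0 k).ne'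
    simp only [Complex.real_smul, Complex.ofReal_inv, Complex.ofReal_mul]
    field_simp
  rw [hdiff, norm_smul, Real.norm_of_nonneg (inv_nonneg.2 hN.le), recursionMean, smul_eq_mul]
  refine mul_le_mul_of_nonneg_left (norm_sum_le_of_le _ fun k _ => ?_) (inv_nonneg.2 hN.le)
  rw [norm_mul, norm_mul, Complex.norm_real, Real.norm_of_nonneg (hv0 _).le, smul_eq_mul,
    mul_right_comm]
  have hmk := hp.norm_le_of_norm_twist_le_one hm (fun i => (hv0 i).le) hφ k
  have := (hv0 (n - 1 - k)).le
  gcongr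

theorem norm_abelMean_twist_sub_le (hp : IsExpCoeff v p) (hm : IsExpCoeff (fun i => v i * φ i) m)
    (hv : ∀ i, 0 < v i) (hB : ∀ i, v i ≤ B) (hφ : ∀ i, ‖φ i‖ ≤ 1) {A : ℕ → ℂ}
    (hA : ∀ k, ‖A k‖ ≤ M) {s : ℝ} {L : ℂ} (hs0 : 0 ≤ s) (hs1 : s < 1)
    (hL : genSeries m s = genSeries p s * L) :
    ‖abelMean p (fun k => (p k)⁻¹ • m k - A k) s‖ ≤ abelMean p (fun k => ‖A k - L‖) s := by
  have hv0 : ∀ i, 0 ≤ v i := fun i => (hv i).le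
  have hG := hp.genSeries_pos hv0 hB hs0 hs1
  have hsum := hp.summableOnUnitBall_of_nonneg hv0 hB
  have hmsum := (hsum.of_norm_le (hp.norm_le_of_norm_twist_le_one hm hv0 hφ)).hasSum_genSeries
    (z := (s : ℂ)) (by rwa [Complex.norm_real, Real.norm_of_nonneg hs0])
  have hpL := (hsum.hasSum_genSeries (z := s) (by rwa [Real.norm_of_nonneg hs0])).smul_const L
  have hAL : ∀ k, ‖A k - L‖ ≤ M + ‖L‖ := fun k =>
    (norm_sub_le _ _).trans (add_le_add_left (hA k) _)
  have hALsum := hsum.summable_norm_smul hAL hs0 hs1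
  have hzero : HasSum (fun k => m k * (s : ℂ) ^ k - (p k * s ^ k) • L) 0 := by
    simpa [hL] using hmsum.sub hpL
  have hval := (hzero.sub hALsum.of_norm.hasSum).tsum_eq
  have hterm : ∀ k, m k * (s : ℂ) ^ k - (p k * s ^ k) • L - (p k * s ^ k) • (A k - L)
      = (p k * s ^ k) • ((p k)⁻¹ • m k - A k) := fun k => by
    have hpk : (p k : ℂ) ≠ 0 := Complex.ofReal_ne_zero.2 (hp.pos hv k).ne'
    simp only [Complex.real_smul, Complex.ofReal_inv, Complex.ofReal_mul, Complex.ofReal_pow]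
    field_simp
    ring
  simp only [hterm, zero_sub] at hval
  rw [abelMean, hval, norm_smul, norm_neg, Real.norm_of_nonneg (inv_nonneg.2 hG.le)]
  refine mul_le_mul_of_nonneg_left ((norm_tsum_le_tsum_norm hALsum).trans_eq ?_)
    (inv_nonneg.2 hG.le)
  refine tsum_congr fun k => ?_
  rw [norm_smul, Real.norm_of_nonneg (mul_nonneg (hp.pos hv k).le (pow_nonneg hs0 k)),
    smul_eq_mul]

theorem tendsto_twist_sub_of_slowlyVarying (hp : IsExpCoeff v p)
    (hm : IsExpCoeff (fun i => v i * φ i) m) (hθ : 0 < θ) (hv : ∀ i, θ ≤ v i) (hB : ∀ i, v i ≤ B)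
    (hφ : ∀ i, ‖φ i‖ ≤ 1) (hlim : Tendsto φ atTop (𝓝 1)) (hF : SlowlyVaryingAtOne F)
    (hM : ∀ s, 0 ≤ s → ‖F s‖ ≤ M)
    (hgen : ∀ s : ℝ, 0 ≤ s → s < 1 → genSeries m (s : ℂ) = genSeries p s * F s) :
    Tendsto (fun n => (p n)⁻¹ • m n - F (expRadius 1 n)) atTop (𝓝 0) := by
  have hv0 : ∀ i, 0 < v i := fun i => hθ.trans_le (hv i)
  have hA : ∀ k, ‖F (expRadius 1 k)‖ ≤ M := fun k => hM _ (expRadius_pos 1 k).le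
  have hIoo := Ioo_mem_nhdsLT (zero_lt_one (α := ℝ))
  have hMM : ∀ᶠ s in 𝓝[<] (1 : ℝ), ∀ k : ℕ, ‖F (expRadius 1 k) - F s‖ ≤ M + M := by
    filter_upwards [hIoo] with s hs k
    exact (norm_sub_le _ _).trans (add_le_add (hA k) (hM s hs.1.le))
  refine hp.tendsto_zero_of_abelMean hθ hv hB (M := 1 + M) (fun k => (norm_sub_le _ _).trans
    (add_le_add (hp.norm_inv_smul_le_one hm hv0 hφ k) (hA k))) ?_ ?_
  · refine squeeze_zero_norm' ?_ (hp.tendsto_abelMean_norm_sub hθ hv hB hF hMM)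
    filter_upwards [hIoo] with s hs
    exact hp.norm_abelMean_twist_sub_le hm hv0 hB hφ hA hs.1.le hs.2 (hgen s hs.1.le hs.2)
  · have h := (hp.tendsto_twist_sub_recursionMean hm hθ hv hB hφ hlim).sub
      (hp.tendsto_sub_recursionMean_of_slowlyVarying hθ hv hB hF hMM)
    rw [sub_zero] at h
    refine h.congr fun n => ?_
    rw [recursionMean_sub]
    abel

theorem genSeries_twist_eq (hp : IsExpCoeff v p) (hm : IsExpCoeff (fun i => v i * φ i) m)
    (hv : ∀ i, 0 ≤ v i) (hB : ∀ i, v i ≤ B) (hφ : ∀ i, ‖φ i‖ ≤ 1) {s : ℝ} (hs0 : 0 ≤ s)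
    (hs1 : s < 1) : genSeries m (s : ℂ)
      = genSeries p s * Complex.exp (logSeries (fun i => v i * (φ i - 1)) (s : ℂ)) := by
  have hs : ‖(s : ℂ)‖ < 1 := by rwa [Complex.norm_real, Real.norm_of_nonneg hs0]
  have hvB : ∀ i, ‖(v i : ℂ)‖ ≤ B := fun i => by
    rw [Complex.norm_real, Real.norm_of_nonneg (hv i)]
    exact hB i
  have hvφ : ∀ i, ‖(v i : ℂ) * φ i‖ ≤ B := fun i => by
    rw [norm_mul]
    exact (mul_le_of_le_one_right (norm_nonneg _) (hφ i)).trans (hvB i)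
  have hlog : logSeries (fun i => v i * φ i) (s : ℂ)
      = logSeries v s + logSeries (fun i => v i * (φ i - 1)) (s : ℂ) := by
    have hreal : ((logSeries v s : ℝ) : ℂ) = logSeries (fun i => (v i : ℂ)) (s : ℂ) := by
      simp only [logSeries, Complex.ofReal_tsum]
      push_cast
      rfl
    rw [hreal, ← logSeries_add (.of_bounded hvB) (.of_bounded (norm_mul_sub_one_le hv hB hφ)) hs]
    congr 1
    ext i
    ring
  rw [hm.genSeries_eq_exp hvφ hs, ← Complex.exp_eq_exp_ℂ, hlog, Complex.exp_add,
    hp.genSeries_eq_realExp hv hB hs0 hs1, Complex.ofReal_exp]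

theorem tendsto_twist_sub_exp_logSeries (hp : IsExpCoeff v p)
    (hm : IsExpCoeff (fun i => v i * φ i) m) (hθ : 0 < θ) (hv : ∀ i, θ ≤ v i) (hB : ∀ i, v i ≤ B)
    (hφ : ∀ i, ‖φ i‖ ≤ 1) (hlim : Tendsto φ atTop (𝓝 1)) :
    Tendsto (fun n => (p n)⁻¹ • m n
      - Complex.exp (logSeries (fun i => v i * (φ i - 1)) (expRadius 1 n : ℂ))) atTop (𝓝 0) := by
  have hv0 : ∀ i, 0 ≤ v i := fun i => hθ.le.trans (hv i)
  have ha : Tendsto (fun i => (v i : ℂ) * (φ i - 1)) atTop (𝓝 0) := by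
    refine squeeze_zero_norm (fun i => ?_)
      (by simpa using (tendsto_iff_norm_sub_tendsto_zero.1 hlim).const_mul B)
    rw [norm_mul, Complex.norm_real, Real.norm_of_nonneg (hv0 i)]
    exact mul_le_mul_of_nonneg_right (hB i) (norm_nonneg _)
  have hre : ∀ i, ((v i : ℂ) * (φ i - 1)).re ≤ 0 := fun i => by
    rw [Complex.re_ofReal_mul, Complex.sub_re, Complex.one_re]
    exact mul_nonpos_of_nonneg_of_nonpos (hv0 i)
      (sub_nonpos.2 ((Complex.re_le_norm _).trans (hφ i)))
  have hle : ∀ s : ℝ, 0 ≤ s → ‖Complex.exp (logSeries (fun i => v i * (φ i - 1)) (s : ℂ))‖ ≤ 1 :=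
    fun s hs => norm_exp_logSeries_le_one hre hs
  exact hp.tendsto_twist_sub_of_slowlyVarying hm hθ hv hB hφ hlim
    ((slowlyVaryingAtOne_logSeries ha).cexp (by
      filter_upwards [Ioo_mem_nhdsLT (zero_lt_one (α := ℝ))] with s hs using hle s hs.1.le)) hle
    fun s hs0 hs1 => hp.genSeries_twist_eq hm hv0 hB hφ hs0 hs1

end IsExpCoeff

end Twist

theorem multFun_mul {R : Type*} [CommMonoid R] (g h : ℕ → R) {n : ℕ} (σ : Equiv.Perm (Fin n)) :
    multFun (fun j => g j * h j) σ = multFun g σ * multFun h σ := by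
  simp only [multFun, mul_pow, Finset.prod_mul_distrib]

theorem multFun_ofReal (d : ℕ → ℝ) {n : ℕ} (σ : Equiv.Perm (Fin n)) :
    multFun (fun j => (d j : ℂ)) σ = ((multFun d σ : ℝ) : ℂ) := by
  simp only [multFun]
  push_cast
  rfl

theorem weightedMean_eq_div (d : ℕ → ℝ) (f : ℕ → ℂ) (n : ℕ) :
    weightedMean d f n = (∑ σ : Equiv.Perm (Fin n), multFun f σ * ((multFun d σ : ℝ) : ℂ)) /
      (∑ σ : Equiv.Perm (Fin n), ((multFun d σ : ℝ) : ℂ)) := by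
  rw [weightedMean, Finset.sum_div]
  refine Finset.sum_congr rfl fun σ _ => ?_
  rw [permWeight]
  push_cast
  rw [mul_div_assoc]

theorem weightedMean_eq_inv_smul (d : ℕ → ℝ) (f : ℕ → ℂ) (n : ℕ) :
    weightedMean d f n = ((∑ σ : Equiv.Perm (Fin n), multFun d σ) / (n.factorial : ℝ))⁻¹ •
      ((∑ σ : Equiv.Perm (Fin n), multFun (fun j => d j * f j) σ) / (n.factorial : ℂ)) := by
  have hn : (n.factorial : ℂ) ≠ 0 := Nat.cast_ne_zero.2 n.factorial_ne_zero
  have hsum : ∑ σ : Equiv.Perm (Fin n), multFun f σ * ((multFun d σ : ℝ) : ℂ)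
      = ∑ σ : Equiv.Perm (Fin n), multFun (fun j => d j * f j) σ :=
    Finset.sum_congr rfl fun σ _ => by rw [multFun_mul, multFun_ofReal, mul_comm]
  rw [weightedMean_eq_div, hsum, Complex.real_smul]
  push_cast
  rw [inv_div, div_mul_div_comm, mul_comm (n.factorial : ℂ), mul_div_mul_right _ _ hn]

theorem expSeriesTerm_succ_eq (d : ℕ → ℝ) (f : ℕ → ℂ) (n j : ℕ) :
    expSeriesTerm d f n (j + 1)
      = d (j + 1) * (f (j + 1) - 1) * (expRadius 1 n : ℂ) ^ (j + 1) / (j + 1) := by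
  have h : Real.exp (-((j + 1 : ℕ) : ℝ) / (n : ℝ)) = expRadius 1 n ^ (j + 1) := by
    rw [expRadius, ← Real.exp_nat_mul]
    congr 1
    ring
  rw [expSeriesTerm, h, Complex.ofReal_pow]
  push_cast
  ring

theorem mainTheorem9 (d : ℕ → ℝ) (dlo dhi : ℝ) (hdlo : 0 < dlo)
    (hd : ∀ j : ℕ, 1 ≤ j → dlo ≤ d j ∧ d j ≤ dhi)
    (f : ℕ → ℂ) (hf : ∀ j : ℕ, 1 ≤ j → ‖f j‖ ≤ 1)
    (hlim : Tendsto f atTop (𝓝 1)) :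
    (∀ n : ℕ, 1 ≤ n → weightedMean d f n =
      (∑ σ : Equiv.Perm (Fin n), multFun f σ * ((multFun d σ : ℝ) : ℂ)) /
        (∑ σ : Equiv.Perm (Fin n), ((multFun d σ : ℝ) : ℂ))) ∧
    (∀ n : ℕ, 1 ≤ n → Summable (fun j : ℕ => expSeriesTerm d f n (j + 1))) ∧
    Tendsto (fun n : ℕ =>
      weightedMean d f n - Complex.exp (∑' j : ℕ, expSeriesTerm d f n (j + 1)))
      atTop (𝓝 0) := by
  have hlo : ∀ i, dlo ≤ d (i + 1) := fun i => (hd _ i.succ_pos).1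
  have hhi : ∀ i, d (i + 1) ≤ dhi := fun i => (hd _ i.succ_pos).2
  have hf1 : ∀ i, ‖f (i + 1)‖ ≤ 1 := fun i => hf _ i.succ_pos
  simp only [expSeriesTerm_succ_eq, weightedMean_eq_inv_smul]
  refine ⟨fun n _ => ?_, fun n hn => ?_, ?_⟩
  · rw [← weightedMean_eq_inv_smul, weightedMean_eq_div]
  · refine SummableOnUnitBall.summable_logSeries (.of_bounded
      (norm_mul_sub_one_le (fun i => hdlo.le.trans (hlo i)) hhi hf1)) ?_
    rw [Complex.norm_real, Real.norm_of_nonneg (expRadius_pos 1 n).le]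
    exact expRadius_lt_one one_pos hn
  · exact (isExpCoeff_sum_multFun d).tendsto_twist_sub_exp_logSeries
      (isExpCoeff_sum_multFun fun j => (d j : ℂ) * f j) hdlo hlo hhi hf1
      ((tendsto_add_atTop_iff_nat 1).2 hlim)
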